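/- An affine $n$-manifold is a manifold with an atlas of charts in $\mathbb R^n$ whose transition maps are locally affine (equivalently, a smooth manifold with a flat torsion-free connection $\nabla$, the connection for which the coordinate vector fields of these charts are parallel). Its linear holonomy at $x$ is the group of automorphisms of $T_xL$ given by $\nabla$-parallel transport along loops at $x$. Let $(L_0,\nabla)$ be a compact connected Hausdorff affine manifold of dimension $n\ge 0$, let $x_0\in L_0$, and let $b=(b_1,\dots,b_n)$ be a basis of $T_{x_0}L_0$ in which every element of the linear holonomy at $x_0$ has its matrix in $GL(n,\mathbb Z)$. For $x\in L_0$ let $\Lambda_x\subset T^*_xL_0$ be the group of covectors that take integral values on the parallel transports to $x$, along all paths from $x_0$ to $x$, of $b_1,\dots,b_n$. Then there are a compact Hausdorff smooth manifold $M$ of dimension $2n$, a symplectic form $\omega$ on $M$ (smooth, closed, nondegenerate), an $n$-dimensional smooth foliation $\mathcal F$ of $M$ that is Lagrangian for $\omega$, and maps $\pi:T^*L_0\to M$ and $p:M\to L_0$, such that: 1. $L_0$ is a leaf of $\mathcal F$: the map $\iota:L_0\to M$, $\iota(x)=\pi(0_x)$, is a smooth embedding tangent to $\mathcal F$ whose image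 is a leaf. Moreover the affine structure of $L_0$ is the one that $\mathcal F$ induces on its leaf (Libermann–Weinstein): around each point of $\iota(L_0)$ there are coordinates $(p_1,\dots,p_n,q_1,\dots,q_n)$ of $M$ in which $\mathcal F$ is given by $dq_1=\dots=dq_n=0$ and $\omega=\sum_i dp_i\wedge dq_i$, and such that $(p_1\circ\iota,\dots,p_n\circ\iota)$ are affine coordinates of $L_0$. 2. $M$ is the quotient of $T^*L_0$ by the fibrewise integer translations: $\pi$ is a surjective local diffeomorphism, and $\pi(\alpha)=\pi(\beta)$ if and only if $\alpha,\beta$ lie in the same fibre $T_x^*L_0$ and $\beta-\alpha\in\Lambda_x$. 3. $\omega$ is induced by the canonical symplectic form of $T^*L_0$: $\pi^*\omega=-d\theta$, where $\theta$ is the Liouville form. 4. $M$ is a $T^n$-bundle over $L_0$, a suspension of $T^n=(\mathbb R/\mathbb Z)^n$ with horizontal foliation $\mathcal F$: $p\circ\pi$ is the projection $T^*L_0\to L_0$, and $p$ has smooth local trivializations $p^{-1}(U)\cong U\times T^n$ under which, for each $t\in T^n$, the slice $U\times\{t\}$ is tangent to $\mathcal F$. -/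

import Mathlib

open scoped Manifold ContDiff Topology

open Bundle Set

universe u

noncomputable section

namespace AffSymp

/-- `ℝⁿ`, the model space of `n`-manifolds. -/
abbrev Euc (n : ℕ) : Type := EuclideanSpace ℝ (Fin n)

/-- The model with corners of `2n`-manifolds, the model space `ℝ²ⁿ` being written `ℝⁿ × ℝⁿ`. -/
abbrev dbl (n : ℕ) : ModelWithCorners ℝ (Euc n × Euc n) (Euc n × Euc n) :=
  𝓘(ℝ, Euc n × Euc n)

/-! ### Affine manifolds -/

/-- The maps between open subsets of `ℝⁿ` that are locally restrictions of affine maps. -/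
def affinePregroupoid (n : ℕ) : Pregroupoid (Euc n) where
  property f s := ∀ x ∈ s, ∃ A : Euc n →ᵃ[ℝ] Euc n, ∀ᶠ z in 𝓝 x, f z = A z
  comp := by
    intro f g u v hf hg hu hv huv x hx
    obtain ⟨A, hA⟩ := hf x hx.1
    obtain ⟨B, hB⟩ := hg (f x) hx.2
    refine ⟨B.comp A, ?_⟩
    have hc : ContinuousAt f x := by
      have h1 : ContinuousAt A x := A.continuous_of_finiteDimensional.continuousAt
      exact h1.congr (hA.mono fun z hz => hz.symm)
    filter_upwards [hA, hc.eventually hB] with z h1 h2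
    show g (f z) = B (A z)
    rw [h2, h1]
  id_mem := fun x _ => ⟨AffineMap.id ℝ _, by simp⟩
  locality := by
    intro f u _ h x hx
    obtain ⟨v, _, hxv, hv⟩ := h x hx
    exact hv x ⟨hx, hxv⟩
  congr := by
    intro f g u hu hfg hf x hx
    obtain ⟨A, hA⟩ := hf x hx
    refine ⟨A, ?_⟩
    filter_upwards [hA, hu.mem_nhds hx] with z h1 h2
    rw [hfg z h2, h1]

/-- The groupoid of local homeomorphisms of `ℝⁿ` that are locally affine. -/
def affineGroupoid (n : ℕ) : StructureGroupoid (Euc n) :=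
  (affinePregroupoid n).groupoid

/-- An affine `n`-manifold: a manifold whose atlas has locally affine transition maps.
(The atlas carries the same information as the flat torsion-free connection for which the
coordinate vector fields of the charts are parallel.) -/
abbrev IsAffineManifold (n : ℕ) (L : Type*) [TopologicalSpace L] [ChartedSpace (Euc n) L] : Prop :=
  HasGroupoid L (affineGroupoid n)

theorem affineGroupoid_le (n : ℕ) : affineGroupoid n ≤ contDiffGroupoid ∞ (𝓡 n) := by
  refine groupoid_of_pregroupoid_le _ _ ?_
  intro f s hf
  show ContDiffOn ℝ ∞ _ _
  intro x hx
  obtain ⟨A, hA⟩ := hf x (by simpa using hx)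
  have h1 : ContDiff ℝ ∞ A := (⟨A, A.continuous_of_finiteDimensional⟩ : Euc n →ᴬ[ℝ] Euc n).contDiff
  refine ContDiffAt.contDiffWithinAt (h1.contDiffAt.congr_of_eventuallyEq ?_)
  filter_upwards [hA] with z hz
  simpa using hz

/-- An affine manifold is a smooth manifold. -/
instance isManifold_of_isAffineManifold (n : ℕ) (L : Type*) [TopologicalSpace L]
    [ChartedSpace (Euc n) L] [IsAffineManifold n L] : IsManifold (𝓡 n) ∞ L where
  toHasGroupoid := hasGroupoid_of_le inferInstance (affineGroupoid_le n)

section Affine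

variable {n : ℕ} {L : Type*} [TopologicalSpace L] [ChartedSpace (Euc n) L]

/-- `w ∈ T_yL` is the parallel transport of `v ∈ T_xL` along the path `γ` from `x` to `y`, for the
flat connection of the affine structure: there is a vector field `V` along `γ` from `v` to `w`
whose components in each affine chart are locally constant. -/
def IsParallelTransport {x y : L} (γ : Path x y)
    (v : TangentSpace (𝓡 n) x) (w : TangentSpace (𝓡 n) y) : Prop :=
  ∃ V : unitInterval → TangentBundle (𝓡 n) L,
    (∀ t, (V t).proj = γ t) ∧ V 0 = ⟨x, v⟩ ∧ V 1 = ⟨y, w⟩ ∧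
    ∀ t, ∀ φ ∈ atlas (Euc n) L, γ t ∈ φ.source → ∀ᶠ s in 𝓝 t,
      (mfderiv (𝓡 n) (𝓡 n) φ (V s).proj (V s).snd : Euc n) =
        mfderiv (𝓡 n) (𝓡 n) φ (V t).proj (V t).snd

/-- The linear holonomy at `x`: the linear maps of `T_xL` given by parallel transport along
the loops at `x`. -/
def linearHolonomy (x : L) : Set (TangentSpace (𝓡 n) x →ₗ[ℝ] TangentSpace (𝓡 n) x) :=
  {T | ∃ γ : Path x x, ∀ v, IsParallelTransport γ v (T v)}

/-- In the basis `b` of `T_xL`, the linear holonomy is contained in `GL(n, ℤ)`. -/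
def HasIntegralHolonomy {x : L} (b : Module.Basis (Fin n) ℝ (TangentSpace (𝓡 n) x)) : Prop :=
  ∀ T ∈ linearHolonomy x, ∃ A : GL (Fin n) ℤ,
    LinearMap.toMatrix b b T = (A : Matrix (Fin n) (Fin n) ℤ).map (Int.cast : ℤ → ℝ)

end Affine

/-! ### Differential forms -/

section Forms

variable {E : Type*} [NormedAddCommGroup E] [NormedSpace ℝ E] {H : Type*} [TopologicalSpace H]
  (I : ModelWithCorners ℝ E H) (M : Type*) [TopologicalSpace M] [ChartedSpace H M]

/-- Differential `k`-forms on a manifold, without smoothness condition. -/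
abbrev DiffForm (k : ℕ) : Type _ := ∀ x : M, TangentSpace I x [⋀^Fin k]→L[ℝ] ℝ

variable {I M} {k : ℕ}

/-- The expression of a form in the preferred chart at `x`, that is, its pullback by the inverse
of this chart. (All manifolds considered here are without boundary.) -/
def DiffForm.inChart (Ω : DiffForm I M k) (x : M) : E → E [⋀^Fin k]→L[ℝ] ℝ := fun y =>
  (Ω ((extChartAt I x).symm y)).compContinuousLinearMap
    (mfderiv 𝓘(ℝ, E) I (extChartAt I x).symm y)

/-- A form is smooth if its expressions in charts are. -/
def DiffForm.IsSmooth (Ω : DiffForm I M k) : Prop :=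
  ∀ x : M, ContDiffOn ℝ ∞ (DiffForm.inChart Ω x) (extChartAt I x).target

/-- The exterior derivative of a form, computed at `x` in the preferred chart at `x`. -/
def DiffForm.d (Ω : DiffForm I M k) : DiffForm I M (k + 1) := fun x =>
  (extDeriv (DiffForm.inChart Ω x) (extChartAt I x x)).compContinuousLinearMap
    (mfderiv I 𝓘(ℝ, E) (extChartAt I x) x)

/-- A symplectic form: a smooth, closed, nondegenerate `2`-form. -/
structure IsSymplectic (Ω : DiffForm I M 2) : Prop where
  smooth : DiffForm.IsSmooth Ω
  closed : ∀ x, DiffForm.d Ω x = 0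
  nondegenerate : ∀ (x : M) (v : TangentSpace I x), (∀ w, Ω x ![v, w] = 0) → v = 0

end Forms

/-! ### The cotangent bundle -/

section Cotangent

variable (n : ℕ) (L : Type*) [TopologicalSpace L] [ChartedSpace (Euc n) L]
  [IsManifold (𝓡 n) ∞ L]

/-- The cotangent bundle `T*L`, with the manifold structure of the bundle `Hom(TL, ℝ)`. -/
abbrev Cotangent : Type _ :=
  TotalSpace (Euc n →L[ℝ] ℝ) (fun x : L => TangentSpace (𝓡 n) x →L[ℝ] ℝ)

/-- The model with corners of the cotangent bundle. -/
abbrev cot : ModelWithCorners ℝ (Euc n × (Euc n →L[ℝ] ℝ)) (ModelProd (Euc n) (Euc n →L[ℝ] ℝ)) :=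
  (𝓡 n).prod 𝓘(ℝ, Euc n →L[ℝ] ℝ)

/-- The Liouville form `θ` of `T*L`: `θ_α(v) = α(dp(v))`, where `p : T*L → L`. -/
def liouville : DiffForm (cot n) (Cotangent n L) 1 := fun α =>
  ContinuousAlternatingMap.ofSubsingleton ℝ (TangentSpace (cot n) α) ℝ (0 : Fin 1)
    (α.snd ∘L mfderiv (cot n) (𝓡 n) (TotalSpace.proj : Cotangent n L → L) α)

/-- The canonical symplectic form `-dθ` of `T*L`. -/
def canonicalForm : DiffForm (cot n) (Cotangent n L) 2 := fun α => -(DiffForm.d (liouville n L) α)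

variable {n L}

/-- For a basis `b` of `T_{x₀}L`, the covectors at `x` that take integral values on the parallel
transports to `x` of the members of `b`. -/
def integralCovectors {x₀ : L} (b : Module.Basis (Fin n) ℝ (TangentSpace (𝓡 n) x₀)) (x : L) :
    AddSubgroup (TangentSpace (𝓡 n) x →L[ℝ] ℝ) where
  carrier := {a | ∀ (γ : Path x₀ x) (i : Fin n) (w : TangentSpace (𝓡 n) x),
    IsParallelTransport γ (b i) w → ∃ k : ℤ, a w = k}
  add_mem' := by
    intro a c ha hc γ i w hw
    obtain ⟨k, hk⟩ := ha γ i w hw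
    obtain ⟨l, hl⟩ := hc γ i w hw
    exact ⟨k + l, by simp [hk, hl]⟩
  zero_mem' := fun _ _ _ _ => ⟨0, by simp⟩
  neg_mem' := by
    intro a ha γ i w hw
    obtain ⟨k, hk⟩ := ha γ i w hw
    exact ⟨-k, by simp [hk]⟩

/-- `β` is obtained from `α` by translation, in a fibre of `T*L`, by an integral covector. -/
def IsIntegralTranslate {x₀ : L} (b : Module.Basis (Fin n) ℝ (TangentSpace (𝓡 n) x₀))
    (α β : Cotangent n L) : Prop :=
  ∃ (x : L) (a : TangentSpace (𝓡 n) x →L[ℝ] ℝ), ∃ c ∈ integralCovectors b x,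
    α = ⟨x, a⟩ ∧ β = ⟨x, a + c⟩

end Cotangent

/-! ### Foliations -/

section Foliations

variable (n : ℕ) (M : Type*) [TopologicalSpace M] [ChartedSpace (Euc n × Euc n) M]

/-- A smooth foliation of dimension `n` on a `2n`-manifold, given by a foliated atlas: smooth
charts `φ = (φ₁, φ₂)` that cover the manifold and whose changes of coordinates locally send the
slices `φ₂ = const` to each other. -/
structure Foliation where
  charts : Set (OpenPartialHomeomorph M (Euc n × Euc n))
  smooth : charts ⊆ IsManifold.maximalAtlas (dbl n) ∞ M
  cover : ∀ x : M, ∃ φ ∈ charts, x ∈ φ.source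
  compatible : ∀ φ ∈ charts, ∀ ψ ∈ charts, ∀ x ∈ φ.source ∩ ψ.source, ∃ U ∈ 𝓝 x,
    ∀ y ∈ U, ∀ z ∈ U, (φ y).2 = (φ z).2 → (ψ y).2 = (ψ z).2

namespace Foliation

variable {n M} (F : Foliation n M)

/-- Near `x`, the map `f` takes its values in one slice of a foliated chart. -/
def IsLeafwiseAt {X : Type*} [TopologicalSpace X] (f : X → M) (x : X) : Prop :=
  ∃ φ ∈ F.charts, f x ∈ φ.source ∧
    ∀ᶠ z in 𝓝 x, f z ∈ φ.source ∧ (φ (f z)).2 = (φ (f x)).2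

/-- The leaf through `x`: the points that are joined to `x` by a path which locally stays in
slices of foliated charts. -/
def leaf (x : M) : Set M :=
  {y | ∃ γ : Path x y, ∀ t, F.IsLeafwiseAt γ t}

/-- A foliation (of half the dimension) is Lagrangian if `Ω` vanishes on the tangent spaces of
its leaves. -/
def IsLagrangian (Ω : DiffForm (dbl n) M 2) : Prop :=
  ∀ φ ∈ F.charts, ∀ x ∈ φ.source, ∀ v w : TangentSpace (dbl n) x,
    (mfderiv (dbl n) (dbl n) φ x v : Euc n × Euc n).2 = 0 →
    (mfderiv (dbl n) (dbl n) φ x w : Euc n × Euc n).2 = 0 → Ω x ![v, w] = 0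

/-- `φ = (p, q)` is a Darboux chart adapted to the foliation: a smooth chart in which the
foliation is given by `dq = 0` and `Ω` is `∑ dpᵢ ∧ dqᵢ`. -/
structure IsAdaptedDarboux (Ω : DiffForm (dbl n) M 2)
    (φ : OpenPartialHomeomorph M (Euc n × Euc n)) : Prop where
  smooth : φ ∈ IsManifold.maximalAtlas (dbl n) ∞ M
  adapted : ∀ ψ ∈ F.charts, ∀ x ∈ φ.source ∩ ψ.source, ∃ U ∈ 𝓝 x,
    ∀ y ∈ U, ∀ z ∈ U, (φ y).2 = (φ z).2 ↔ (ψ y).2 = (ψ z).2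
  darboux : ∀ x ∈ φ.source, ∀ v w : TangentSpace (dbl n) x,
    Ω x ![v, w] =
      ∑ i : Fin n,
        ((mfderiv (dbl n) (dbl n) φ x v : Euc n × Euc n).1 i *
            (mfderiv (dbl n) (dbl n) φ x w : Euc n × Euc n).2 i -
          (mfderiv (dbl n) (dbl n) φ x w : Euc n × Euc n).1 i *
            (mfderiv (dbl n) (dbl n) φ x v : Euc n × Euc n).2 i)

variable {L : Type*} [TopologicalSpace L] [ChartedSpace (Euc n) L]

/-- `ι` is a diffeomorphism of the (compact) manifold `L` onto an embedded leaf. -/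
structure IsLeafEmbedding (ι : L → M) : Prop where
  smoothEmbedding : Manifold.IsSmoothEmbedding (𝓡 n) (dbl n) ∞ ι
  leafwise : ∀ x, F.IsLeafwiseAt ι x
  range_eq : ∀ x, range ι = F.leaf (ι x)

/-- The affine structure of `L` is the Libermann–Weinstein affine structure of the leaf `ι(L)` of
the Lagrangian foliation: the restrictions to the leaf of the coordinates `p` of adapted
Darboux charts `(p, q)` are affine coordinates of `L`. -/
def InducesAffineStructure (Ω : DiffForm (dbl n) M 2) (ι : L → M) : Prop :=
  ∀ x : L, ∃ φ : OpenPartialHomeomorph M (Euc n × Euc n), F.IsAdaptedDarboux Ω φ ∧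
    ι x ∈ φ.source ∧
    ∃ A : Euc n ≃ᵃ[ℝ] Euc n, ∀ᶠ z in 𝓝 x, (φ (ι z)).1 = A (chartAt (Euc n) x z)

/-- `p : M → L` is a smooth bundle with fibre the torus `Tⁿ = (ℝ/ℤ)ⁿ`, and a suspension whose
horizontal foliation is `F`: it has smooth local trivializations
over open sets `U` under which the slices `U × {t}` lie in leaves of `F`. Smoothness is tested on
the map `U × ℝⁿ → U × Tⁿ → M`, which has to be a local diffeomorphism. -/
def IsTorusSuspension (p : M → L) : Prop :=
  ∀ x : L, ∃ e : Trivialization (Fin n → UnitAddCircle) p, x ∈ e.baseSet ∧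
    IsLocalDiffeomorphOn ((𝓡 n).prod 𝓘(ℝ, Fin n → ℝ)) (dbl n) ∞
      (fun q : L × (Fin n → ℝ) =>
        e.toOpenPartialHomeomorph.symm (q.1, fun i => (q.2 i : UnitAddCircle)))
      (e.baseSet ×ˢ univ) ∧
    ∀ t : Fin n → UnitAddCircle, ∀ y ∈ e.baseSet,
      F.IsLeafwiseAt (fun z => e.toOpenPartialHomeomorph.symm (z, t)) y

end Foliation

end Foliations

end AffSymp

end

open AffSymp

/-! An affine chart of `L` gives canonical coordinates `(p, q)` on `T*L`: `p` is the affine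
coordinate of the base point and `q` the coordinate vector of the covector. When the base chart
changes by an affine map with linear part `B`, the covector changes by the inverse transpose of `B`,
which is locally constant. So the coordinate changes of `T*L` are locally affine, they preserve `∑
dpᵢ ∧ dqᵢ = -dθ`, and they send slices `q = const` to such slices (`exists_cotChart_transition`,
`canonicalForm_apply`).

Parallel transport has constant components in an affine chart. Integral holonomy makes the
transports of `b` along different paths integer combinations of each other, so one path suffices to
test whether a covector is integral. Hence in canonical coordinates the integral covectors form
locally a constant lattice, and an integral translation is a translation `(0, d)`
(`exists_isIntegralTranslate_iff`, `exists_local_translation`). This is again affine, symplectic and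
slice-preserving.

The quotient map is therefore a local homeomorphism, and its local inverses give the quotient an
atlas with transitions in `sympAffineGroupoid` (`exists_cotCoord_transition`, `hasGroupoid`). On any
manifold with such an atlas the standard form and the slices `q = const` define a symplectic form
and a Lagrangian foliation, whose charts are adapted Darboux charts. Pairing `q` with a basis of the
dual lattice identifies each fibre with `ℝⁿ/ℤⁿ`, locally uniformly over the base
(`exists_trivialization`); compactness, separation and the suspension structure follow. The zero
section is locally the slice `q = 0`, parametrized by the affine coordinate `p`, and it is a whole
leaf because it is compact (`range_zeroSection`).

Existence and uniqueness of parallel transport come from covering theory: with the discrete topology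
on its fibres, the tangent bundle is a covering of `L` (`isCoveringMap_flatCore`), and parallel
fields along a path are its lifts (`isParallelTransport_iff`). -/

set_option linter.unusedSectionVars false

noncomputable section

namespace AffSymp

/-! ### Derivatives of vector-valued functions -/

section VectorValued

variable {E : Type*} [NormedAddCommGroup E] [NormedSpace ℝ E] {H : Type*} [TopologicalSpace H]
  {I : ModelWithCorners ℝ E H} {M : Type*} [TopologicalSpace M] [ChartedSpace H M]
  {F : Type*} [NormedAddCommGroup F] [NormedSpace ℝ F]
  {F' : Type*} [NormedAddCommGroup F'] [NormedSpace ℝ F']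

theorem mvfderiv_apply (f : M → F) (x : M) (v : TangentSpace I x) :
    mvfderiv I f x v = (mfderiv I 𝓘(ℝ, F) f x v : F) := rfl

theorem mvfderiv_eq_of_eventuallyEq {f g : M → F} {x : M} (h : f =ᶠ[𝓝 x] g)
    (v : TangentSpace I x) : mvfderiv I f x v = mvfderiv I g x v := by
  rw [mvfderiv_apply, mvfderiv_apply]
  exact DFunLike.congr_fun h.mfderiv_eq v

theorem mvfderiv_clm_comp (A : F →L[ℝ] F') {f : M → F} {x : M}
    (hf : MDifferentiableAt I 𝓘(ℝ, F) f x) (v : TangentSpace I x) :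
    mvfderiv I (fun y => A (f y)) x v = A (mvfderiv I f x v) := by
  have h2 : mfderiv I 𝓘(ℝ, F') (A ∘ f) x = _ :=
    mfderiv_comp (I' := 𝓘(ℝ, F)) x A.differentiableAt.mdifferentiableAt hf
  have h3 := DFunLike.congr_fun h2 v
  rw [mfderiv_eq_fderiv, A.fderiv] at h3
  exact h3

theorem mvfderiv_eq_of_affine [FiniteDimensional ℝ F] (A : F →ᵃ[ℝ] F') {f : M → F} {g : M → F'}
    {x : M} (hf : MDifferentiableAt I 𝓘(ℝ, F) f x) (h : ∀ᶠ y in 𝓝 x, g y = A (f y))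
    (v : TangentSpace I x) : mvfderiv I g x v = A.linear (mvfderiv I f x v) := by
  set A' : F →ᴬ[ℝ] F' := ⟨A, A.continuous_of_finiteDimensional⟩
  have h2 : mfderiv I 𝓘(ℝ, F') (A' ∘ f) x = _ :=
    mfderiv_comp (I' := 𝓘(ℝ, F)) x (A'.differentiable.differentiableAt.mdifferentiableAt) hf
  have h3 := DFunLike.congr_fun h2 v
  rw [mfderiv_eq_fderiv, A'.fderiv] at h3
  have h4 : mfderiv I 𝓘(ℝ, F') g x = mfderiv I 𝓘(ℝ, F') (A' ∘ f) x :=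
    Filter.EventuallyEq.mfderiv_eq h
  exact (DFunLike.congr_fun h4 v).trans h3

theorem DiffForm.inChart_apply {k : ℕ} (Ω : DiffForm I M k) (x : M) (y : E) (v : Fin k → E) :
    DiffForm.inChart Ω x y v = Ω ((extChartAt I x).symm y)
      (fun i => mfderiv 𝓘(ℝ, E) I (extChartAt I x).symm y (v i)) := rfl

theorem DiffForm.d_apply {k : ℕ} (Ω : DiffForm I M k) (x : M)
    (v : Fin (k + 1) → TangentSpace I x) :
    DiffForm.d Ω x v = extDeriv (DiffForm.inChart Ω x) (extChartAt I x x)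
      (fun i => mvfderiv I (extChartAt I x) x (v i)) := rfl

end VectorValued

/-! ### Manifolds with symplectic affine transition maps -/

section SymplecticAffine

/-- The standard symplectic form `∑ dpᵢ ∧ dqᵢ` of `ℝⁿ × ℝⁿ`. -/
def stdForm (n : ℕ) : (Euc n × Euc n) [⋀^Fin 2]→L[ℝ] ℝ :=
  -ContinuousAlternatingMap.alternatizeUncurryFin
    ((ContinuousAlternatingMap.ofSubsingletonLIE (𝕜 := ℝ) (E := Euc n × Euc n) (F := ℝ)
        (0 : Fin 1)).toLinearIsometry.toContinuousLinearMap ∘L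
      (((ContinuousLinearMap.compL ℝ (Euc n × Euc n) (Euc n) ℝ).flip
        (ContinuousLinearMap.fst ℝ (Euc n) (Euc n))) ∘L (innerSL ℝ) ∘L
          (ContinuousLinearMap.snd ℝ (Euc n) (Euc n))))

theorem stdForm_apply_inner {n : ℕ} (v w : Euc n × Euc n) :
    stdForm n ![v, w] = inner ℝ w.2 v.1 - inner ℝ v.2 w.1 := by
  have h : stdForm n ![v, w] = innerSL ℝ w.2 v.1 + -innerSL ℝ v.2 w.1 := by
    simp only [stdForm, ContinuousAlternatingMap.neg_apply,
      ContinuousAlternatingMap.alternatizeUncurryFin_apply]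
    simp [Fin.removeNth]
    rfl
  rw [h, sub_eq_add_neg]
  rfl

theorem stdForm_apply {n : ℕ} (v w : Euc n × Euc n) :
    stdForm n ![v, w] = ∑ i, (v.1 i * w.2 i - w.1 i * v.2 i) := by
  rw [stdForm_apply_inner, Finset.sum_sub_distrib]
  simp [PiLp.inner_apply]

theorem eq_zero_of_stdForm {n : ℕ} {v : Euc n × Euc n} (h : ∀ w, stdForm n ![v, w] = 0) :
    v = 0 := by
  -- These two test vectors give `|v.1|²` and `-|v.2|²`.
  have h1 := h (0, v.1)
  have h2 := h (v.2, 0)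
  simp only [stdForm_apply_inner, inner_zero_left, inner_zero_right, sub_zero, zero_sub,
    neg_eq_zero, inner_self_eq_zero] at h1 h2
  exact Prod.ext h1 h2

/-- The affine maps of `ℝⁿ × ℝⁿ` that preserve the standard symplectic form and send horizontal
slices to horizontal slices. -/
def IsSymplecticAffine {n : ℕ} (A : Euc n × Euc n →ᵃ[ℝ] Euc n × Euc n) : Prop :=
  (∀ v w, stdForm n ![A.linear v, A.linear w] = stdForm n ![v, w]) ∧
    ∀ v, v.2 = 0 → (A.linear v).2 = 0

/-- The maps between open subsets of `ℝⁿ × ℝⁿ` that are locally symplectic affine maps preserving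
the horizontal foliation. -/
def sympAffinePregroupoid (n : ℕ) : Pregroupoid (Euc n × Euc n) where
  property f s := ∀ x ∈ s, ∃ A : Euc n × Euc n →ᵃ[ℝ] Euc n × Euc n,
    IsSymplecticAffine A ∧ ∀ᶠ z in 𝓝 x, f z = A z
  comp := by
    intro f g u v hf hg _ _ _ x hx
    obtain ⟨A, hA, hfA⟩ := hf x hx.1
    obtain ⟨B, hB, hgB⟩ := hg (f x) hx.2
    refine ⟨B.comp A, ⟨fun v w => ?_, fun v hv => ?_⟩, ?_⟩
    · simp [hA.1, hB.1]
    · exact hB.2 _ (hA.2 v hv)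
    · have hc : ContinuousAt f x :=
        A.continuous_of_finiteDimensional.continuousAt.congr (hfA.mono fun z hz => hz.symm)
      filter_upwards [hfA, hc.eventually hgB] with z h1 h2
      rw [Function.comp_apply, h2, h1, AffineMap.comp_apply]
  id_mem := fun x _ => ⟨AffineMap.id ℝ _, ⟨by simp, by simp⟩, by simp⟩
  locality := by
    intro f u _ h x hx
    obtain ⟨v, _, hxv, hv⟩ := h x hx
    exact hv x ⟨hx, hxv⟩
  congr := by
    intro f g u hu hfg hf x hx
    obtain ⟨A, hA, hfA⟩ := hf x hx
    refine ⟨A, hA, ?_⟩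
    filter_upwards [hfA, hu.mem_nhds hx] with z h1 h2
    rw [hfg z h2, h1]

/-- The groupoid of local homeomorphisms of `ℝⁿ × ℝⁿ` that are locally symplectic affine and
preserve the horizontal foliation. -/
def sympAffineGroupoid (n : ℕ) : StructureGroupoid (Euc n × Euc n) :=
  (sympAffinePregroupoid n).groupoid

theorem exists_of_mem_sympAffineGroupoid {n : ℕ}
    {e : OpenPartialHomeomorph (Euc n × Euc n) (Euc n × Euc n)} (he : e ∈ sympAffineGroupoid n)
    {x : Euc n × Euc n} (hx : x ∈ e.source) :
    ∃ A : Euc n × Euc n →ᵃ[ℝ] Euc n × Euc n, IsSymplecticAffine A ∧ ∀ᶠ z in 𝓝 x, e z = A z :=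
  (mem_groupoid_of_pregroupoid.1 he).1 x hx

theorem sympAffineGroupoid_le (n : ℕ) : sympAffineGroupoid n ≤ contDiffGroupoid ∞ (dbl n) := by
  refine groupoid_of_pregroupoid_le _ _ ?_
  intro f s hf
  show ContDiffOn ℝ ∞ _ _
  intro x hx
  obtain ⟨A, -, hA⟩ := hf x (by simpa using hx)
  have h1 : ContDiff ℝ ∞ A := (⟨A, A.continuous_of_finiteDimensional⟩ :
    Euc n × Euc n →ᴬ[ℝ] Euc n × Euc n).contDiff
  refine ContDiffAt.contDiffWithinAt (h1.contDiffAt.congr_of_eventuallyEq ?_)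
  filter_upwards [hA] with z hz
  simpa using hz

variable {n : ℕ} {M : Type*} [TopologicalSpace M] [ChartedSpace (Euc n × Euc n) M]

theorem isManifold_of_sympAffine [HasGroupoid M (sympAffineGroupoid n)] : IsManifold (dbl n) ∞ M where
  toHasGroupoid := hasGroupoid_of_le inferInstance (sympAffineGroupoid_le n)

theorem mem_maximalAtlas_of_sympAffine {φ : OpenPartialHomeomorph M (Euc n × Euc n)}
    (hφ : φ ∈ (sympAffineGroupoid n).maximalAtlas M) : φ ∈ IsManifold.maximalAtlas (dbl n) ∞ M :=
  StructureGroupoid.maximalAtlas_mono (sympAffineGroupoid_le n) hφ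

theorem mdifferentiableAt_of_sympAffine {φ : OpenPartialHomeomorph M (Euc n × Euc n)}
    (hφ : φ ∈ (sympAffineGroupoid n).maximalAtlas M) {x : M} (hx : x ∈ φ.source) :
    MDifferentiableAt (dbl n) (dbl n) φ x :=
  (contMDiffAt_of_mem_maximalAtlas (mem_maximalAtlas_of_sympAffine hφ) hx).mdifferentiableAt
    (by simp)

theorem exists_transition {φ ψ : OpenPartialHomeomorph M (Euc n × Euc n)}
    (hφ : φ ∈ (sympAffineGroupoid n).maximalAtlas M)
    (hψ : ψ ∈ (sympAffineGroupoid n).maximalAtlas M) {x : M} (hx : x ∈ φ.source)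
    (hx' : x ∈ ψ.source) :
    ∃ A : Euc n × Euc n →ᵃ[ℝ] Euc n × Euc n, IsSymplecticAffine A ∧ ∀ᶠ y in 𝓝 x, ψ y = A (φ y) := by
  obtain ⟨A, hA, h⟩ := exists_of_mem_sympAffineGroupoid
    ((sympAffineGroupoid n).compatible_of_mem_maximalAtlas hφ hψ) (x := φ x) (by simp [hx, hx'])
  refine ⟨A, hA, ?_⟩
  filter_upwards [(φ.continuousAt hx).eventually h, φ.open_source.mem_nhds hx] with y h1 h2
  simpa [h2] using h1

variable [HasGroupoid M (sympAffineGroupoid n)]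

variable (n M) in
/-- The symplectic form whose expression in the charts is the standard one. -/
def sympAffineForm : DiffForm (dbl n) M 2 := fun _ => stdForm n

/-- The tangent space at `x` is the model space itself, identified through the preferred chart at
`x`; in that chart the formula is the definition. Another chart differs from it near `x` by an
affine map whose linear part preserves `stdForm`. -/
theorem sympAffineForm_apply {φ : OpenPartialHomeomorph M (Euc n × Euc n)}
    (hφ : φ ∈ (sympAffineGroupoid n).maximalAtlas M) {x : M} (hx : x ∈ φ.source)
    (v w : TangentSpace (dbl n) x) :
    sympAffineForm n M x ![v, w] = stdForm n ![mvfderiv (dbl n) φ x v, mvfderiv (dbl n) φ x w] := by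
  have : IsManifold (dbl n) ∞ M := isManifold_of_sympAffine
  have : IsManifold (dbl n) 1 M := IsManifold.of_le (n := ∞) (by simp)
  have hc := (sympAffineGroupoid n).chart_mem_maximalAtlas x
  obtain ⟨A, hA, h⟩ := exists_transition hc hφ (mem_chart_source _ x) hx
  have hid (u : TangentSpace (dbl n) x) :
      mvfderiv (dbl n) (chartAt (Euc n × Euc n) x) x u = (u : Euc n × Euc n) :=
    DFunLike.congr_fun (mfderiv_extChartAt_self (I := dbl n) (x := x)) u
  have hd := mdifferentiableAt_of_sympAffine hc (mem_chart_source _ x)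
  rw [mvfderiv_eq_of_affine A hd h, mvfderiv_eq_of_affine A hd h, hA.1, hid, hid]
  rfl

theorem sympAffineForm_inChart {x : M} :
    EqOn (DiffForm.inChart (sympAffineForm n M) x) (fun _ => stdForm n)
      (extChartAt (dbl n) x).target := by
  have : IsManifold (dbl n) ∞ M := isManifold_of_sympAffine
  have : IsManifold (dbl n) 1 M := IsManifold.of_le (n := ∞) (by simp)
  intro y hy
  have hy' : (extChartAt (dbl n) x).symm y ∈ (chartAt (Euc n × Euc n) x).source := by
    simpa using (extChartAt (dbl n) x).map_target hy
  have h2 := mfderiv_extChartAt_comp_mfderivWithin_extChartAt_symm hy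
  rw [modelWithCornersSelf_coe, range_id, mfderivWithin_univ] at h2
  have h3 (u : Euc n × Euc n) :
      mvfderiv (dbl n) (chartAt (Euc n × Euc n) x) ((extChartAt (dbl n) x).symm y)
        (mfderiv (dbl n) (dbl n) (extChartAt (dbl n) x).symm y u) = u := DFunLike.congr_fun h2 u
  ext v
  have h1 := sympAffineForm_apply ((sympAffineGroupoid n).chart_mem_maximalAtlas x) hy'
    (mfderiv (dbl n) (dbl n) (extChartAt (dbl n) x).symm y (v 0))
    (mfderiv (dbl n) (dbl n) (extChartAt (dbl n) x).symm y (v 1))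
  rw [h3, h3] at h1
  have hv : v = ![v 0, v 1] := by ext i : 1; fin_cases i <;> rfl
  rw [DiffForm.inChart_apply]
  conv_rhs => rw [hv]
  refine Eq.trans ?_ h1
  congr 1
  ext i : 1; fin_cases i <;> rfl

theorem isSymplectic_sympAffineForm : IsSymplectic (sympAffineForm n M) where
  smooth x := contDiffOn_const.congr sympAffineForm_inChart
  closed x := by
    have h1 : DiffForm.inChart (sympAffineForm n M) x =ᶠ[𝓝 (extChartAt (dbl n) x x)]
        fun _ => stdForm n :=
      sympAffineForm_inChart.eventuallyEq_of_mem (extChartAt_target_mem_nhds x)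
    -- The form has constant coefficients in the chart, so its derivative vanishes.
    ext v
    rw [DiffForm.d_apply, h1.extDeriv_eq, extDeriv, fderiv_fun_const,
      ContinuousAlternatingMap.alternatizeUncurryFin_apply]
    simp
  nondegenerate x v h := eq_zero_of_stdForm h

variable (n M) in
/-- The foliation by the slices `q = const` of the charts `(p, q)`. -/
def sympAffineFoliation : Foliation n M where
  charts := (sympAffineGroupoid n).maximalAtlas M
  smooth _ h := mem_maximalAtlas_of_sympAffine h
  cover x := ⟨chartAt _ x, (sympAffineGroupoid n).chart_mem_maximalAtlas x, mem_chart_source _ x⟩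
  compatible φ hφ ψ hψ x hx := by
    obtain ⟨A, hA, h⟩ := exists_transition hφ hψ hx.1 hx.2
    refine ⟨_, h, fun y hy z hz hyz => ?_⟩
    -- Only the difference of the two points matters; it is horizontal, and the linear part of `A`
    -- keeps it horizontal.
    rw [hy, hz, ← sub_eq_zero, ← Prod.snd_sub, ← vsub_eq_sub, ← AffineMap.linearMap_vsub]
    exact hA.2 _ (by simp [hyz])

theorem isLagrangian_sympAffineFoliation :
    (sympAffineFoliation n M).IsLagrangian (sympAffineForm n M) := by
  intro φ hφ x hx v w hv hw
  have hv' : (mvfderiv (dbl n) φ x v).2 = 0 := hv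
  have hw' : (mvfderiv (dbl n) φ x w).2 = 0 := hw
  rw [sympAffineForm_apply hφ hx, stdForm_apply_inner, hv', hw']
  simp

theorem isAdaptedDarboux_sympAffine {φ : OpenPartialHomeomorph M (Euc n × Euc n)}
    (hφ : φ ∈ (sympAffineGroupoid n).maximalAtlas M) :
    (sympAffineFoliation n M).IsAdaptedDarboux (sympAffineForm n M) φ where
  smooth := mem_maximalAtlas_of_sympAffine hφ
  adapted ψ hψ x hx := by
    obtain ⟨U, hU, h⟩ := (sympAffineFoliation n M).compatible φ hφ ψ hψ x hx
    obtain ⟨V, hV, h'⟩ := (sympAffineFoliation n M).compatible ψ hψ φ hφ x hx.symm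
    exact ⟨U ∩ V, Filter.inter_mem hU hV, fun y hy z hz =>
      ⟨h y hy.1 z hz.1, h' y hy.2 z hz.2⟩⟩
  darboux x hx v w := by
    rw [sympAffineForm_apply hφ hx, stdForm_apply]
    rfl

end SymplecticAffine

/-! ### Parallel transport on affine manifolds -/

section ParallelTransport

variable {n : ℕ} {L : Type*} [TopologicalSpace L] [ChartedSpace (Euc n) L]

/-- Vectors lying in the fibres over `γ t` can be added and scaled pointwise, unlike points of the
total space. The end conditions stay in the total space because `γ 0` and `x` are not the same by
definition. -/
theorem IsParallelTransport.exists_field {x y : L} {γ : Path x y} {v : TangentSpace (𝓡 n) x}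
    {w : TangentSpace (𝓡 n) y} (h : IsParallelTransport γ v w) :
    ∃ V : ∀ t, TangentSpace (𝓡 n) (γ t), (⟨γ 0, V 0⟩ : TangentBundle (𝓡 n) L) = ⟨x, v⟩ ∧
      (⟨γ 1, V 1⟩ : TangentBundle (𝓡 n) L) = ⟨y, w⟩ ∧
      ∀ t, ∀ φ ∈ atlas (Euc n) L, γ t ∈ φ.source → ∀ᶠ s in 𝓝 t,
        mvfderiv (𝓡 n) φ (γ s) (V s) = mvfderiv (𝓡 n) φ (γ t) (V t) := by
  obtain ⟨V, hV, h0, h1, h⟩ := h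
  have h2 : ∀ t, ∃ u : TangentSpace (𝓡 n) (γ t), V t = ⟨γ t, u⟩ := by
    intro t
    rw [← hV t]
    exact ⟨(V t).snd, rfl⟩
  choose U hU using h2
  refine ⟨U, by rw [← hU, h0], by rw [← hU, h1], fun t φ hφ ht => ?_⟩
  have key : ∀ {p : TangentBundle (𝓡 n) L} {q : L} {u : TangentSpace (𝓡 n) q}, p = ⟨q, u⟩ →
      mvfderiv (𝓡 n) φ p.proj p.snd = mvfderiv (𝓡 n) φ q u := by
    rintro _ _ _ rfl
    rfl
  filter_upwards [h t φ hφ ht] with s hs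
  rw [← key (hU s), ← key (hU t)]
  exact hs

theorem IsParallelTransport.linear_combination {x y : L} {γ : Path x y}
    {v v' : TangentSpace (𝓡 n) x} {w w' : TangentSpace (𝓡 n) y} (c d : ℝ)
    (h : IsParallelTransport γ v w) (h' : IsParallelTransport γ v' w') :
    IsParallelTransport γ (c • v + d • v') (c • w + d • w') := by
  obtain ⟨V, h0, h1, h⟩ := h.exists_field
  obtain ⟨V', h0', h1', h'⟩ := h'.exists_field
  have key : ∀ {p q : L} {a a' : TangentSpace (𝓡 n) p} {e e' : TangentSpace (𝓡 n) q},
      (⟨p, a⟩ : TangentBundle (𝓡 n) L) = ⟨q, e⟩ → (⟨p, a'⟩ : TangentBundle (𝓡 n) L) = ⟨q, e'⟩ →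
      (⟨p, c • a + d • a'⟩ : TangentBundle (𝓡 n) L) = ⟨q, c • e + d • e'⟩ := by
    intro p q a a' e e' h1 h2
    obtain rfl : p = q := congr_arg TotalSpace.proj h1
    rw [TotalSpace.mk_inj.1 h1, TotalSpace.mk_inj.1 h2]
  refine ⟨fun t => ⟨γ t, c • V t + d • V' t⟩, fun t => rfl, key h0 h0', key h1 h1',
    fun t φ hφ ht => ?_⟩
  filter_upwards [h t φ hφ ht, h' t φ hφ ht] with s hs hs'
  show mvfderiv (𝓡 n) φ (γ s) (c • V s + d • V' s) = mvfderiv (𝓡 n) φ (γ t) (c • V t + d • V' t)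
  rw [map_add, map_add, map_smul, map_smul, map_smul, map_smul, hs, hs']

theorem IsParallelTransport.add {x y : L} {γ : Path x y} {v v' : TangentSpace (𝓡 n) x}
    {w w' : TangentSpace (𝓡 n) y} (h : IsParallelTransport γ v w)
    (h' : IsParallelTransport γ v' w') : IsParallelTransport γ (v + v') (w + w') := by
  simpa using h.linear_combination 1 1 h'

theorem IsParallelTransport.smul {x y : L} {γ : Path x y} {v : TangentSpace (𝓡 n) x}
    {w : TangentSpace (𝓡 n) y} (c : ℝ) (h : IsParallelTransport γ v w) :
    IsParallelTransport γ (c • v) (c • w) := by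
  simpa using h.linear_combination c 0 h

variable [IsAffineManifold n L]

theorem exists_affine_transition {φ ψ : OpenPartialHomeomorph L (Euc n)}
    (hφ : φ ∈ atlas (Euc n) L) (hψ : ψ ∈ atlas (Euc n) L) {x : L} (hx : x ∈ φ.source)
    (hx' : x ∈ ψ.source) : ∃ A : Euc n →ᵃ[ℝ] Euc n, ∀ᶠ y in 𝓝 x, ψ y = A (φ y) := by
  have h0 := (affineGroupoid n).compatible hφ hψ
  obtain ⟨A, hA⟩ := (mem_groupoid_of_pregroupoid.1 h0).1 (φ x) (by simp [hx, hx'])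
  refine ⟨A, ?_⟩
  filter_upwards [(φ.continuousAt hx).eventually hA, φ.open_source.mem_nhds hx] with y h1 h2
  simpa [h2] using h1

theorem mdifferentiableAt_of_mem_atlas {φ : OpenPartialHomeomorph L (Euc n)}
    (hφ : φ ∈ atlas (Euc n) L) {x : L} (hx : x ∈ φ.source) :
    MDifferentiableAt (𝓡 n) (𝓡 n) φ x :=
  (mdifferentiable_of_mem_atlas hφ).mdifferentiableAt hx

theorem eventually_mvfderiv_eq {φ ψ : OpenPartialHomeomorph L (Euc n)}
    {x : L} {A : Euc n →ᵃ[ℝ] Euc n} (hφ : φ ∈ atlas (Euc n) L) (hx : x ∈ φ.source)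
    (hA : ∀ᶠ y in 𝓝 x, ψ y = A (φ y)) :
    ∀ᶠ y in 𝓝 x, ∀ v : TangentSpace (𝓡 n) y,
      mvfderiv (𝓡 n) ψ y v = A.linear (mvfderiv (𝓡 n) φ y v) := by
  filter_upwards [eventually_eventually_nhds.2 hA, φ.open_source.mem_nhds hx] with y h1 h2 v
  exact mvfderiv_eq_of_affine A (mdifferentiableAt_of_mem_atlas hφ h2) h1 v

theorem isInvertible_mvfderiv {φ : OpenPartialHomeomorph L (Euc n)}
    (hφ : φ ∈ atlas (Euc n) L) {x : L} (hx : x ∈ φ.source) :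
    (mvfderiv (𝓡 n) φ x).IsInvertible :=
  ⟨(mdifferentiable_of_mem_atlas (I := 𝓡 n) hφ).mfderiv hx, rfl⟩

/-- The inverse of the differential at `x` of the chart `φ`, extended by `0`. -/
def chartInverse (φ : OpenPartialHomeomorph L (Euc n)) (x : L) (v : Euc n) :
    TangentSpace (𝓡 n) x := (mvfderiv (𝓡 n) φ x).inverse v

theorem mvfderiv_chartInverse {φ : OpenPartialHomeomorph L (Euc n)}
    (hφ : φ ∈ atlas (Euc n) L) {x : L} (hx : x ∈ φ.source) (v : Euc n) :
    mvfderiv (𝓡 n) φ x (chartInverse φ x v) = v :=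
  DFunLike.congr_fun (isInvertible_mvfderiv hφ hx).self_comp_inverse v

theorem chartInverse_mvfderiv {φ : OpenPartialHomeomorph L (Euc n)}
    (hφ : φ ∈ atlas (Euc n) L) {x : L} (hx : x ∈ φ.source) (v : TangentSpace (𝓡 n) x) :
    chartInverse φ x (mvfderiv (𝓡 n) φ x v) = v :=
  DFunLike.congr_fun (isInvertible_mvfderiv hφ hx).inverse_comp_self v

/-- The fibre `ℝⁿ` with the discrete topology. -/
def FlatFibre (n : ℕ) : Type := Euc n

instance (n : ℕ) : TopologicalSpace (FlatFibre n) := ⊥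

instance (n : ℕ) : DiscreteTopology (FlatFibre n) := ⟨rfl⟩

variable (n L) in
/-- The tangent bundle of an affine manifold as a bundle with discrete fibres. Its continuous
sections are the parallel vector fields. -/
def flatCore : FiberBundleCore (atlas (Euc n) L) L (FlatFibre n) where
  baseSet i := i.1.source
  isOpen_baseSet i := i.1.open_source
  indexAt := achart (Euc n)
  mem_baseSet_at x := mem_chart_source (Euc n) x
  coordChange i j x v := mvfderiv (𝓡 n) j.1 x (chartInverse i.1 x v)
  coordChange_self i x hx v := mvfderiv_chartInverse i.2 hx v
  continuousOn_coordChange i j := by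
    rintro ⟨x, v⟩ ⟨⟨hi, hj⟩, -⟩
    obtain ⟨A, hA⟩ := exists_affine_transition i.2 j.2 hi hj
    refine ContinuousAt.continuousWithinAt ?_
    have h1 : ∀ᶠ p : L × FlatFibre n in 𝓝 (x, v), p.2 = v := by
      exact continuousAt_snd.eventually ((isOpen_discrete {v}).mem_nhds (mem_singleton v))
    -- The transition map is affine near `x`, so its differential is the constant `A.linear`; this
    -- gives continuity even for the discrete topology on the fibre.
    refine (continuousAt_const (Y := FlatFibre n) (y := A.linear v)).congr ?_
    filter_upwards [h1, continuousAt_fst.eventually (eventually_mvfderiv_eq i.2 hi hA),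
      continuousAt_fst.eventually (i.1.open_source.mem_nhds hi)] with p hp h2 h3
    have h4 := h2 (chartInverse i.1 p.1 p.2)
    exact ((h4.trans (congr_arg A.linear (mvfderiv_chartInverse i.2 h3 p.2))).trans
      (congr_arg A.linear hp)).symm
  coordChange_comp i j k x hx v := by
    rw [chartInverse_mvfderiv j.2 hx.1.2]

/-- A tangent vector as a point of the flat bundle. -/
def toFlat (p : TangentBundle (𝓡 n) L) : (flatCore n L).TotalSpace :=
  ⟨p.proj, mvfderiv (𝓡 n) (chartAt (Euc n) p.proj) p.proj p.snd⟩

/-- The tangent vector defined by a point of the flat bundle. -/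
def ofFlat (p : (flatCore n L).TotalSpace) : TangentBundle (𝓡 n) L :=
  ⟨p.proj, chartInverse (chartAt (Euc n) p.proj) p.proj p.snd⟩

theorem ofFlat_toFlat (p : TangentBundle (𝓡 n) L) : ofFlat (toFlat p) = p := by
  cases p with
  | mk x v =>
    simp only [ofFlat, toFlat]
    rw [chartInverse_mvfderiv (chart_mem_atlas _ x) (mem_chart_source _ x)]

theorem toFlat_ofFlat (p : (flatCore n L).TotalSpace) : toFlat (ofFlat p) = p := by
  cases p with
  | mk x v =>
    exact TotalSpace.mk_inj.2 (mvfderiv_chartInverse (chart_mem_atlas _ x) (mem_chart_source _ x) v)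

theorem localTriv_snd (p : (flatCore n L).TotalSpace) (i : atlas (Euc n) L) :
    ((flatCore n L).localTriv i p).2 = mvfderiv (𝓡 n) i.1 p.proj (ofFlat p).snd := rfl

theorem localTriv_toFlat (p : TangentBundle (𝓡 n) L) (i : atlas (Euc n) L) :
    ((flatCore n L).localTriv i (toFlat p)).2 = mvfderiv (𝓡 n) i.1 p.proj p.snd := by
  rw [localTriv_snd, ofFlat_toFlat]
  rfl

/-- For a map into a discrete fibre, continuity means local constancy. So a continuous lift of `γ`
to the flat bundle is the same as a field along `γ` with locally constant components in charts. -/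
theorem isParallelTransport_iff {x y : L} {γ : Path x y} {v : TangentSpace (𝓡 n) x}
    {w : TangentSpace (𝓡 n) y} : IsParallelTransport γ v w ↔
      ∃ Γ : Path (toFlat ⟨x, v⟩) (toFlat ⟨y, w⟩), ∀ t, (Γ t).proj = γ t := by
  constructor
  · rintro ⟨V, hV, h0, h1, h⟩
    refine ⟨⟨⟨fun t => toFlat (V t), ?_⟩, by simp [h0], by simp [h1]⟩, hV⟩
    refine continuous_iff_continuousAt.2 fun t => ?_
    rw [FiberBundle.continuousAt_totalSpace]
    have hγ : (fun s => (toFlat (V s)).proj) = γ := funext hV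
    refine ⟨hγ ▸ γ.continuous.continuousAt, ?_⟩
    have ht : γ t ∈ (chartAt (Euc n) (γ t)).source := mem_chart_source _ _
    have h2 := h t _ (chart_mem_atlas (Euc n) (γ t)) ht
    refine (continuousAt_const (Y := FlatFibre n)
      (y := mvfderiv (𝓡 n) (chartAt (Euc n) (γ t)) (V t).proj (V t).snd)).congr ?_
    filter_upwards [h2] with s hs
    have h3 := localTriv_toFlat (V s) (achart (Euc n) (γ t))
    have h4 : (trivializationAt (FlatFibre n) (flatCore n L).Fiber (toFlat (V t)).proj) =
      (flatCore n L).localTriv (achart (Euc n) (γ t)) := by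
      rw [← hV t]; rfl
    rw [h4, h3]
    exact hs.symm
  · rintro ⟨Γ, hΓ⟩
    refine ⟨fun t => ofFlat (Γ t), hΓ, by simp only [Γ.source, ofFlat_toFlat], by
      simp only [Γ.target, ofFlat_toFlat], fun t φ hφ ht => ?_⟩
    have h1 : ContinuousAt (fun s => ((flatCore n L).localTriv ⟨φ, hφ⟩ (Γ s)).2) t := by
      refine ContinuousAt.snd (ContinuousAt.comp (g := (flatCore n L).localTriv ⟨φ, hφ⟩) ?_
        Γ.continuous.continuousAt)
      refine ((flatCore n L).localTriv ⟨φ, hφ⟩).continuousAt ?_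
      rw [Trivialization.mem_source]
      have h2 := ht
      rw [← hΓ t] at h2
      exact h2
    exact h1.eventually ((isOpen_discrete {_}).mem_nhds rfl)

/-- Path lifting yields the existence of parallel transport, and uniqueness of lifts its uniqueness.
-/
theorem isCoveringMap_flatCore :
    IsCoveringMap (TotalSpace.proj : (flatCore n L).TotalSpace → L) :=
  FiberBundle.isCoveringMap (F := FlatFibre n) (E := (flatCore n L).Fiber)

theorem exists_isParallelTransport {x y : L} (γ : Path x y) (v : TangentSpace (𝓡 n) x) :
    ∃ w, IsParallelTransport γ v w := by
  obtain ⟨Γ, h1, h2⟩ := (isCoveringMap_flatCore (n := n) (L := L)).exists_path_lifts γ.toContinuousMap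
    (toFlat ⟨x, v⟩) γ.source
  have h3 : ∀ t, (Γ t).proj = γ t := fun t => congr_fun h1 t
  obtain ⟨w, hw⟩ : ∃ w : TangentSpace (𝓡 n) y, ofFlat (Γ 1) = ⟨y, w⟩ := by
    have h4 : (ofFlat (Γ 1)).proj = y := (h3 1).trans γ.target
    generalize ofFlat (Γ 1) = p at h4
    subst h4
    exact ⟨p.snd, rfl⟩
  exact ⟨w, isParallelTransport_iff.2
    ⟨⟨Γ, h2, by rw [← hw, toFlat_ofFlat]; rfl⟩, h3⟩⟩

theorem IsParallelTransport.unique {x y : L} {γ : Path x y} {v : TangentSpace (𝓡 n) x}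
    {w w' : TangentSpace (𝓡 n) y} (h : IsParallelTransport γ v w)
    (h' : IsParallelTransport γ v w') : w = w' := by
  obtain ⟨Γ, hΓ⟩ := isParallelTransport_iff.1 h
  obtain ⟨Γ', hΓ'⟩ := isParallelTransport_iff.1 h'
  have h1 := isCoveringMap_flatCore.eq_of_comp_eq Γ.continuous Γ'.continuous
    (funext fun t => (hΓ t).trans (hΓ' t).symm) 0 (by simp)
  have h2 := congr_arg ofFlat (congr_fun h1 1)
  rw [Γ.target, Γ'.target, ofFlat_toFlat, ofFlat_toFlat] at h2
  exact (TotalSpace.mk_inj).1 h2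

theorem IsParallelTransport.trans {x y z : L} {γ : Path x y} {δ : Path y z}
    {u : TangentSpace (𝓡 n) x} {v : TangentSpace (𝓡 n) y} {w : TangentSpace (𝓡 n) z}
    (h : IsParallelTransport γ u v) (h' : IsParallelTransport δ v w) :
    IsParallelTransport (γ.trans δ) u w := by
  obtain ⟨Γ, hΓ⟩ := isParallelTransport_iff.1 h
  obtain ⟨Δ, hΔ⟩ := isParallelTransport_iff.1 h'
  refine isParallelTransport_iff.2 ⟨Γ.trans Δ, fun t => ?_⟩
  rw [Path.trans_apply, Path.trans_apply]
  split_ifs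
  · exact hΓ _
  · exact hΔ _

theorem IsParallelTransport.symm {x y : L} {γ : Path x y}
    {v : TangentSpace (𝓡 n) x} {w : TangentSpace (𝓡 n) y}
    (h : IsParallelTransport γ v w) : IsParallelTransport γ.symm w v := by
  obtain ⟨Γ, hΓ⟩ := isParallelTransport_iff.1 h
  exact isParallelTransport_iff.2 ⟨Γ.symm, fun t => hΓ _⟩

/-- The field with constant components in `φ` is parallel: in any other chart its components are the
image of the same vector under a locally constant linear map. -/
theorem isParallelTransport_of_chart {φ : OpenPartialHomeomorph L (Euc n)}
    (hφ : φ ∈ atlas (Euc n) L) {x y : L} {γ : Path x y} (hγ : ∀ t, γ t ∈ φ.source)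
    {v : TangentSpace (𝓡 n) x} {w : TangentSpace (𝓡 n) y}
    (h : mvfderiv (𝓡 n) φ x v = mvfderiv (𝓡 n) φ y w) : IsParallelTransport γ v w := by
  have hx : x ∈ φ.source := by simpa using hγ 0
  have hy : y ∈ φ.source := by simpa using hγ 1
  have key : ∀ {p q : L}, q ∈ φ.source → p = q → ∀ u : TangentSpace (𝓡 n) q,
      (⟨p, chartInverse φ p (mvfderiv (𝓡 n) φ q u)⟩ : TangentBundle (𝓡 n) L) = ⟨q, u⟩ := by
    rintro p _ hq rfl u
    rw [chartInverse_mvfderiv hφ hq]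
  refine ⟨fun t => ⟨γ t, chartInverse φ (γ t) (mvfderiv (𝓡 n) φ x v)⟩, fun t => rfl, ?_, ?_, ?_⟩
  · exact key hx γ.source v
  · rw [h]
    exact key hy γ.target w
  · intro t ψ hψ ht
    obtain ⟨A, hA⟩ := exists_affine_transition hφ hψ (hγ t) ht
    have h1 := eventually_mvfderiv_eq hφ (hγ t) hA
    have h2 : ∀ s, (∀ v : TangentSpace (𝓡 n) (γ s),
        mvfderiv (𝓡 n) ψ (γ s) v = A.linear (mvfderiv (𝓡 n) φ (γ s) v)) →
        mvfderiv (𝓡 n) ψ (γ s) (chartInverse φ (γ s) (mvfderiv (𝓡 n) φ x v)) =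
          A.linear (mvfderiv (𝓡 n) φ x v) := by
      intro s hs
      rw [hs, mvfderiv_chartInverse hφ (hγ s)]
    filter_upwards [γ.continuous.continuousAt.eventually h1] with s hs
    exact (h2 s hs).trans (h2 t h1.self_of_nhds).symm

/-- Parallel transport along a path, as a linear map. -/
def parallelTransport {x y : L} (γ : Path x y) :
    TangentSpace (𝓡 n) x →ₗ[ℝ] TangentSpace (𝓡 n) y where
  toFun v := (exists_isParallelTransport γ v).choose
  map_add' v w := (exists_isParallelTransport γ (v + w)).choose_spec.unique
    ((exists_isParallelTransport γ v).choose_spec.add (exists_isParallelTransport γ w).choose_spec)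
  map_smul' c v := (exists_isParallelTransport γ (c • v)).choose_spec.unique
    ((exists_isParallelTransport γ v).choose_spec.smul c)

theorem isParallelTransport_parallelTransport {x y : L} (γ : Path x y)
    (v : TangentSpace (𝓡 n) x) : IsParallelTransport γ v (parallelTransport γ v) :=
  (exists_isParallelTransport γ v).choose_spec

theorem parallelTransport_mem_linearHolonomy {x : L} (γ : Path x x) :
    parallelTransport (n := n) γ ∈ linearHolonomy x :=
  ⟨γ, fun v => isParallelTransport_parallelTransport γ v⟩

end ParallelTransport

/-! ### The lattice of integral covectors -/

section Lattice

variable {n : ℕ} {L : Type*} [TopologicalSpace L] [ChartedSpace (Euc n) L] [IsAffineManifold n L]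

theorem IsParallelTransport.eq_parallelTransport {x y : L} {γ : Path x y}
    {v : TangentSpace (𝓡 n) x} {w : TangentSpace (𝓡 n) y} (h : IsParallelTransport γ v w) :
    w = parallelTransport γ v :=
  h.unique (isParallelTransport_parallelTransport γ v)

theorem parallelTransport_bijective {x y : L} (γ : Path x y) :
    Function.Bijective (parallelTransport (n := n) γ) := by
  refine Function.bijective_iff_has_inverse.2 ⟨parallelTransport γ.symm, fun v => ?_, fun v => ?_⟩
  · exact ((isParallelTransport_parallelTransport γ v).symm.eq_parallelTransport).symm
  · have h := (isParallelTransport_parallelTransport γ.symm v).symm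
    rw [Path.symm_symm] at h
    exact h.eq_parallelTransport.symm

variable {x₀ : L} {b : Module.Basis (Fin n) ℝ (TangentSpace (𝓡 n) x₀)}

/-- Going out along `γ` and back along `δ` is a loop at `x₀`. The coefficients are the `i`-th column
of its integral holonomy matrix. -/
theorem HasIntegralHolonomy.exists_eq_sum (hb : HasIntegralHolonomy b) {x : L}
    (γ δ : Path x₀ x) (i : Fin n) :
    ∃ m : Fin n → ℤ, parallelTransport γ (b i) = ∑ j, (m j : ℝ) • parallelTransport δ (b j) := by
  set T := parallelTransport (n := n) (γ.trans δ.symm) with hT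
  obtain ⟨A, hA⟩ := hb T (parallelTransport_mem_linearHolonomy _)
  refine ⟨fun j => (A : Matrix (Fin n) (Fin n) ℤ) j i, ?_⟩
  have h1 := ((isParallelTransport_parallelTransport γ (b i)).trans
    (isParallelTransport_parallelTransport δ.symm _)).eq_parallelTransport
  have h2 := (isParallelTransport_parallelTransport δ.symm (parallelTransport γ (b i))).symm
  rw [Path.symm_symm, h1] at h2
  rw [h2.eq_parallelTransport, ← hT, ← b.sum_repr (T (b i)), map_sum]
  refine Finset.sum_congr rfl fun j _ => ?_
  rw [map_smul, ← LinearMap.toMatrix_apply, hA]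
  rfl

/-- Transports along any other path are integer combinations of the transports along `δ`. -/
theorem HasIntegralHolonomy.mem_integralCovectors_iff (hb : HasIntegralHolonomy b) {x : L}
    (δ : Path x₀ x) (a : TangentSpace (𝓡 n) x →L[ℝ] ℝ) :
    a ∈ integralCovectors b x ↔ ∀ j, ∃ k : ℤ, a (parallelTransport δ (b j)) = k := by
  constructor
  · intro h j
    exact h δ j _ (isParallelTransport_parallelTransport δ (b j))
  · intro h γ i w hw
    obtain ⟨m, hm⟩ := hb.exists_eq_sum γ δ i
    choose k hk using h
    refine ⟨∑ j, m j * k j, ?_⟩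
    rw [hw.eq_parallelTransport, hm, map_sum]
    simp [hk]

/-- In an affine chart, the integral covectors form a locally constant lattice. -/
theorem HasIntegralHolonomy.exists_lattice_basis [ConnectedSpace L] (hb : HasIntegralHolonomy b)
    {φ : OpenPartialHomeomorph L (Euc n)} (hφ : φ ∈ atlas (Euc n) L) {q : L} (hq : q ∈ φ.source) :
    ∃ U : Set L, IsOpen U ∧ q ∈ U ∧ U ⊆ φ.source ∧ ∃ c : Module.Basis (Fin n) ℝ (Euc n),
      ∀ y ∈ U, ∀ a : TangentSpace (𝓡 n) y →L[ℝ] ℝ,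
        a ∈ integralCovectors b y ↔ ∀ i, ∃ k : ℤ, a (chartInverse φ y (c i)) = k := by
  have : LocallyPathConnectedSpace L := ChartedSpace.locallyPathConnectedSpace (Euc n) L
  have : PathConnectedSpace L := pathConnectedSpace_iff_connectedSpace.2 inferInstance
  obtain ⟨δ⟩ := PathConnectedSpace.joined x₀ q
  let e : TangentSpace (𝓡 n) q ≃ₗ[ℝ] Euc n := LinearEquiv.ofBijective
    (mvfderiv (𝓡 n) φ q).toLinearMap (Function.bijective_iff_has_inverse.2
      ⟨chartInverse φ q, chartInverse_mvfderiv hφ hq, mvfderiv_chartInverse hφ hq⟩)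
  -- The basis `c` is `b` transported to `q` along `δ` and read in `φ`. A point `y` of this path
  -- component is reached from `q` inside the chart, where transport does not change components, so
  -- the same `c` serves at `y`.
  refine ⟨pathComponentIn φ.source q, φ.open_source.pathComponentIn q,
    mem_pathComponentIn_self hq, pathComponentIn_subset,
    b.map ((LinearEquiv.ofBijective _ (parallelTransport_bijective δ)).trans e), ?_⟩
  intro y hy a
  have hy' : y ∈ φ.source := pathComponentIn_subset hy
  obtain ⟨ε, hε⟩ := (hy : JoinedIn φ.source q y)
  rw [hb.mem_integralCovectors_iff (δ.trans ε)]
  refine forall_congr' fun j => ?_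
  have h1 : mvfderiv (𝓡 n) φ q (parallelTransport δ (b j)) = mvfderiv (𝓡 n) φ y
      (chartInverse φ y (mvfderiv (𝓡 n) φ q (parallelTransport δ (b j)))) := by
    rw [mvfderiv_chartInverse hφ hy']
  have h2 := ((isParallelTransport_parallelTransport δ (b j)).trans
    (isParallelTransport_of_chart hφ hε h1)).eq_parallelTransport
  rw [← h2]
  rfl

end Lattice

/-! ### Canonical coordinates on the cotangent bundle -/

section CotangentChart

variable {n : ℕ} {L : Type*} [TopologicalSpace L] [ChartedSpace (Euc n) L] [IsAffineManifold n L]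

variable (n L) in
/-- The local trivialization of the cotangent bundle over the domain of a preferred chart. -/
abbrev cotTriv (x : L) : Trivialization (Euc n →L[ℝ] ℝ)
    (TotalSpace.proj : Cotangent n L → L) :=
  trivializationAt (Euc n →L[ℝ] ℝ) (fun y : L => TangentSpace (𝓡 n) y →L[ℝ] ℝ) x

theorem cotTriv_baseSet (x : L) : (cotTriv n L x).baseSet = (chartAt (Euc n) x).source := by
  refine (hom_trivializationAt_baseSet (RingHom.id ℝ) x).trans ?_
  simp

theorem cotTriv_fst (x : L) (α : Cotangent n L) : (cotTriv n L x α).1 = α.proj :=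
  congr_arg Prod.fst (hom_trivializationAt_apply (RingHom.id ℝ) x α)

theorem cotTriv_snd_apply (x : L) (α : Cotangent n L)
    (h : α.proj ∈ (chartAt (Euc n) x).source) (v : TangentSpace (𝓡 n) α.proj) :
    (cotTriv n L x α).2 (mvfderiv (𝓡 n) (chartAt (Euc n) x) α.proj v) = α.snd v := by
  have h1 : (cotTriv n L x α).2 = ContinuousLinearMap.inCoordinates (Euc n)
      (TangentSpace (𝓡 n) : L → Type _) ℝ (Bundle.Trivial L ℝ) x α.proj x α.proj α.snd :=
    congr_arg Prod.snd (hom_trivializationAt_apply (RingHom.id ℝ) x α)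
  have h2 : mvfderiv (𝓡 n) (chartAt (Euc n) x) α.proj v =
      (trivializationAt (Euc n) (TangentSpace (𝓡 n)) x).continuousLinearMapAt ℝ α.proj v := by
    rw [TangentBundle.continuousLinearMapAt_trivializationAt h]
    rfl
  have h3 : (trivializationAt (Euc n) (TangentSpace (𝓡 n)) x).symmL ℝ α.proj
      ((trivializationAt (Euc n) (TangentSpace (𝓡 n)) x).continuousLinearMapAt ℝ α.proj v) = v :=
    (trivializationAt (Euc n) (TangentSpace (𝓡 n)) x).symmL_continuousLinearMapAt
      (by simpa using h) v
  have h4 : (trivializationAt ℝ (Bundle.Trivial L ℝ) x).continuousLinearMapAt ℝ α.proj =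
      ContinuousLinearMap.id ℝ ℝ := by
    ext1
    rw [Trivialization.continuousLinearMapAt_apply, Trivialization.linearMapAt_apply]
    simp
  rw [h1, h2, ContinuousLinearMap.inCoordinates, h4]
  exact congr_arg α.snd h3

/-- The canonical coordinates of the cotangent bundle defined by an affine chart of the base. -/
def cotChart (x : L) : OpenPartialHomeomorph (Cotangent n L) (Euc n × Euc n) :=
  (cotTriv n L x).toOpenPartialHomeomorph ≫ₕ (chartAt (Euc n) x).prod
    (InnerProductSpace.toDual ℝ (Euc n)).symm.toHomeomorph.toOpenPartialHomeomorph

theorem cotChart_source (x : L) :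
    (cotChart (n := n) x).source = TotalSpace.proj ⁻¹' (chartAt (Euc n) x).source := by
  ext α
  simp [cotChart, cotTriv_fst]

theorem mem_cotChart_source {x : L} {α : Cotangent n L} :
    α ∈ (cotChart x).source ↔ α.proj ∈ (chartAt (Euc n) x).source := by
  rw [cotChart_source]
  rfl

theorem cotChart_fst (x : L) (α : Cotangent n L) :
    (cotChart x α).1 = chartAt (Euc n) x α.proj :=
  congr_arg (chartAt (Euc n) x) (cotTriv_fst x α)

theorem cotChart_snd (x : L) (α : Cotangent n L) :
    (cotChart x α).2 = (InnerProductSpace.toDual ℝ (Euc n)).symm (cotTriv n L x α).2 := rfl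

/-- This pairing identity determines the fibre coordinate (`cotChart_snd_eq` is the converse). It is
how transitions and translations are computed, without unfolding the bundle trivialization. -/
theorem inner_cotChart_snd {x : L} {α : Cotangent n L}
    (h : α.proj ∈ (chartAt (Euc n) x).source) (v : TangentSpace (𝓡 n) α.proj) :
    inner ℝ (cotChart x α).2 (mvfderiv (𝓡 n) (chartAt (Euc n) x) α.proj v) = α.snd v := by
  rw [cotChart_snd, InnerProductSpace.toDual_symm_apply, cotTriv_snd_apply x α h]

theorem cotChart_target (x : L) :
    (cotChart (n := n) x).target = (chartAt (Euc n) x).target ×ˢ univ := by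
  ext y
  constructor
  · intro hy
    have h1 := (cotChart x).map_target hy
    rw [mem_cotChart_source] at h1
    refine ⟨?_, trivial⟩
    rw [← (cotChart x).right_inv hy, cotChart_fst]
    exact (chartAt (Euc n) x).map_source h1
  · rintro ⟨hy, -⟩
    simp only [cotChart, OpenPartialHomeomorph.trans_target]
    refine ⟨by simpa using hy, ?_⟩
    rw [mem_preimage, Trivialization.mem_target, cotTriv_baseSet]
    exact (chartAt (Euc n) x).map_target hy

theorem mem_cotChart_target {x : L} {y : Euc n × Euc n} :
    y ∈ (cotChart x).target ↔ y.1 ∈ (chartAt (Euc n) x).target := by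
  rw [cotChart_target]
  simp

theorem cotChart_symm_proj {x : L} {y : Euc n × Euc n}
    (hy : y.1 ∈ (chartAt (Euc n) x).target) :
    ((cotChart x).symm y).proj = (chartAt (Euc n) x).symm y.1 := by
  have hy' := mem_cotChart_target.2 hy
  have h1 := cotChart_fst x ((cotChart x).symm y)
  rw [(cotChart x).right_inv hy'] at h1
  rw [h1, (chartAt (Euc n) x).left_inv (mem_cotChart_source.1 ((cotChart x).map_target hy'))]

theorem cotChart_snd_eq {x : L} {α : Cotangent n L} (h : α.proj ∈ (chartAt (Euc n) x).source)
    {ξ : Euc n} (hξ : ∀ v : TangentSpace (𝓡 n) α.proj,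
      inner ℝ ξ (mvfderiv (𝓡 n) (chartAt (Euc n) x) α.proj v) = α.snd v) :
    (cotChart x α).2 = ξ := by
  refine ext_inner_right ℝ fun v => ?_
  have h1 := hξ (chartInverse (chartAt (Euc n) x) α.proj v)
  rw [← inner_cotChart_snd h, mvfderiv_chartInverse (chart_mem_atlas _ x) h] at h1
  exact h1.symm

theorem cotChart_zero {x y : L} (h : y ∈ (chartAt (Euc n) x).source) :
    cotChart x (⟨y, 0⟩ : Cotangent n L) = (chartAt (Euc n) x y, 0) := by
  refine Prod.ext (cotChart_fst _ _) (cotChart_snd_eq h fun v => ?_)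
  simp

theorem cotChart_symm_zero {x y : L} (h : y ∈ (chartAt (Euc n) x).source) :
    (cotChart x).symm (chartAt (Euc n) x y, 0) = (⟨y, 0⟩ : Cotangent n L) := by
  rw [← cotChart_zero h, (cotChart x).left_inv (mem_cotChart_source.2 h)]

theorem cotChart_snd_add {x y : L} (h : y ∈ (chartAt (Euc n) x).source)
    (a c : TangentSpace (𝓡 n) y →L[ℝ] ℝ) :
    (cotChart x (⟨y, a + c⟩ : Cotangent n L)).2 =
      (cotChart x (⟨y, a⟩ : Cotangent n L)).2 + (cotChart x (⟨y, c⟩ : Cotangent n L)).2 := by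
  refine cotChart_snd_eq h fun v => ?_
  rw [inner_add_left]
  exact congr_arg₂ _ (inner_cotChart_snd (α := (⟨y, a⟩ : Cotangent n L)) h v)
    (inner_cotChart_snd (α := (⟨y, c⟩ : Cotangent n L)) h v)

theorem cotChart_symm_mk_proj {x y : L} (hy : y ∈ (chartAt (Euc n) x).source) (ξ : Euc n) :
    ((cotChart x).symm (chartAt (Euc n) x y, ξ)).proj = y := by
  rw [cotChart_symm_proj ((chartAt (Euc n) x).map_source hy), (chartAt (Euc n) x).left_inv hy]

theorem cotChart_cotChart_symm {x y : L} (hy : y ∈ (chartAt (Euc n) x).source) (ξ : Euc n) :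
    cotChart x ((cotChart x).symm (chartAt (Euc n) x y, ξ)) = (chartAt (Euc n) x y, ξ) :=
  (cotChart x).right_inv (mem_cotChart_target.2 ((chartAt (Euc n) x).map_source hy))

theorem cotChart_symm_cotChart {x : L} {α : Cotangent n L}
    (h : α.proj ∈ (chartAt (Euc n) x).source) :
    (cotChart x).symm (chartAt (Euc n) x α.proj, (cotChart x α).2) = α := by
  rw [← cotChart_fst, Prod.mk.eta, (cotChart x).left_inv (mem_cotChart_source.2 h)]

theorem continuousAt_cotChart_symm {x y : L} (hy : y ∈ (chartAt (Euc n) x).source) (ξ : Euc n) :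
    ContinuousAt (fun p : L × Euc n => (cotChart x).symm (chartAt (Euc n) x p.1, p.2)) (y, ξ) := by
  refine ContinuousAt.comp (g := (cotChart x).symm)
    ((cotChart x).continuousAt_symm (mem_cotChart_target.2 ((chartAt (Euc n) x).map_source hy))) ?_
  exact (((chartAt (Euc n) x).continuousAt hy).comp (f := Prod.fst) continuousAt_fst).prodMk
    continuousAt_snd

theorem extChartAt_eq_cotTriv (α β : Cotangent n L) :
    extChartAt (cot n) α β = (chartAt (Euc n) α.proj β.proj, (cotTriv n L α.proj β).2) := by
  have h : chartAt (ModelProd (Euc n) (Euc n →L[ℝ] ℝ)) α β =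
      (chartAt (Euc n) α.proj (cotTriv n L α.proj β).1, (cotTriv n L α.proj β).2) := by
    rw [FiberBundle.chartedSpace_chartAt]
    rfl
  rw [cotTriv_fst] at h
  exact h

/-- Changes of canonical coordinates are symplectic affine. -/
theorem exists_cotChart_transition {x x' : L} {q : L} (hx : q ∈ (chartAt (Euc n) x).source)
    (hx' : q ∈ (chartAt (Euc n) x').source) :
    ∃ A : Euc n × Euc n →ᵃ[ℝ] Euc n × Euc n, IsSymplecticAffine A ∧
      ∀ᶠ q' in 𝓝 q, ∀ α : Cotangent n L, α.proj = q' → cotChart x' α = A (cotChart x α) := by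
  have hφ := chart_mem_atlas (Euc n) x
  have hψ := chart_mem_atlas (Euc n) x'
  obtain ⟨B, hB⟩ := exists_affine_transition hφ hψ hx hx'
  have hB' := eventually_mvfderiv_eq hφ hx hB
  -- At `q`, `B.linear` is the differential of one chart after the inverse differential of the
  -- other.
  have hinj : Function.Injective B.linear := by
    rw [← LinearMap.ker_eq_bot, LinearMap.ker_eq_bot']
    intro v hv
    have h1 := hB'.self_of_nhds (chartInverse (chartAt (Euc n) x) q v)
    rw [mvfderiv_chartInverse hφ hx, hv] at h1
    have h2 := congr_arg (chartInverse (chartAt (Euc n) x') q) h1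
    rw [chartInverse_mvfderiv hψ hx'] at h2
    have h3 := congr_arg (mvfderiv (𝓡 n) (chartAt (Euc n) x) q) h2
    rw [mvfderiv_chartInverse hφ hx] at h3
    rw [h3]
    simp [chartInverse]
  let e : Euc n ≃ₗ[ℝ] Euc n := LinearEquiv.ofInjectiveEndo B.linear hinj
  have he : ∀ v, e v = B.linear v := fun v => rfl
  -- The inverse transpose of `B.linear`. It preserves the pairing of covectors with vectors, which
  -- is what makes `(B, D)` symplectic.
  let D : Euc n →ₗ[ℝ] Euc n := LinearMap.adjoint e.symm.toLinearMap
  have hD : ∀ ξ v, inner ℝ (D ξ) (B.linear v) = inner ℝ ξ v := by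
    intro ξ v
    rw [LinearMap.adjoint_inner_left, ← he]
    simp
  refine ⟨(B.comp (LinearMap.fst ℝ (Euc n) (Euc n)).toAffineMap).prod
    (D.comp (LinearMap.snd ℝ (Euc n) (Euc n))).toAffineMap, ⟨fun v w => ?_, fun v hv => ?_⟩, ?_⟩
  · simp [stdForm_apply_inner, hD]
  · simp [hv]
  · filter_upwards [hB, hB', (chartAt (Euc n) x).open_source.mem_nhds hx,
      (chartAt (Euc n) x').open_source.mem_nhds hx'] with q' h1 h2 h3 h4
    rintro α rfl
    refine Prod.ext ?_ ?_
    · rw [cotChart_fst, h1, ← cotChart_fst]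
      simp
    · refine cotChart_snd_eq h4 fun v => ?_
      rw [h2]
      simp [hD, inner_cotChart_snd h3]

end CotangentChart

/-! ### Integral translations and the Liouville form in canonical coordinates -/

section CanonicalForm

variable {n : ℕ} {L : Type*} [TopologicalSpace L] [ChartedSpace (Euc n) L] [IsAffineManifold n L]

/-- In canonical coordinates, integral translations are the translations by a lattice. -/
theorem HasIntegralHolonomy.exists_isIntegralTranslate_iff [ConnectedSpace L] {x₀ : L}
    {b : Module.Basis (Fin n) ℝ (TangentSpace (𝓡 n) x₀)} (hb : HasIntegralHolonomy b) {x q : L}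
    (hq : q ∈ (chartAt (Euc n) x).source) :
    ∃ U : Set L, IsOpen U ∧ q ∈ U ∧ U ⊆ (chartAt (Euc n) x).source ∧
      ∃ c : Module.Basis (Fin n) ℝ (Euc n), ∀ α β : Cotangent n L, α.proj ∈ U →
        (IsIntegralTranslate b α β ↔ β.proj = α.proj ∧ ∀ i, ∃ k : ℤ,
          inner ℝ ((cotChart x β).2 - (cotChart x α).2) (c i) = k) := by
  obtain ⟨U, hU, hqU, hUs, c, hc⟩ := hb.exists_lattice_basis (chart_mem_atlas (Euc n) x) hq
  refine ⟨U, hU, hqU, hUs, c, ?_⟩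
  have key : ∀ (y : L) (a d : TangentSpace (𝓡 n) y →L[ℝ] ℝ), y ∈ U →
      (d ∈ integralCovectors b y ↔ ∀ i, ∃ k : ℤ,
        inner ℝ ((cotChart x (⟨y, a + d⟩ : Cotangent n L)).2 -
          (cotChart x (⟨y, a⟩ : Cotangent n L)).2) (c i) = k) := by
    intro y a d hy
    rw [hc y hy, cotChart_snd_add (hUs hy), add_sub_cancel_left]
    refine forall_congr' fun i => exists_congr fun k => ?_
    have h1 := inner_cotChart_snd (α := (⟨y, d⟩ : Cotangent n L)) (hUs hy)
      (chartInverse (chartAt (Euc n) x) y (c i))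
    rw [mvfderiv_chartInverse (chart_mem_atlas _ x) (hUs hy)] at h1
    rw [h1]
  intro α β hα
  constructor
  · rintro ⟨y, a, d, hd, rfl, rfl⟩
    exact ⟨rfl, (key y a d hα).1 hd⟩
  · rintro ⟨h1, h2⟩
    obtain ⟨y, a⟩ := α
    obtain ⟨y', a'⟩ := β
    obtain rfl : y' = y := h1
    refine ⟨y', a, a' - a, (key y' a (a' - a) hα).2 ?_, rfl, by rw [add_sub_cancel]⟩
    rw [add_sub_cancel]
    exact h2

variable (n) in
/-- The Liouville form in canonical coordinates. -/
def stdLiouville : Euc n × (Euc n →L[ℝ] ℝ) →L[ℝ] (Euc n × (Euc n →L[ℝ] ℝ)) [⋀^Fin 1]→L[ℝ] ℝ :=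
  (ContinuousAlternatingMap.ofSubsingletonLIE (𝕜 := ℝ) (E := Euc n × (Euc n →L[ℝ] ℝ)) (F := ℝ)
      (0 : Fin 1)).toLinearIsometry.toContinuousLinearMap ∘L
    (((ContinuousLinearMap.compL ℝ (Euc n × (Euc n →L[ℝ] ℝ)) (Euc n) ℝ).flip
      (ContinuousLinearMap.fst ℝ (Euc n) (Euc n →L[ℝ] ℝ))) ∘L
        (ContinuousLinearMap.snd ℝ (Euc n) (Euc n →L[ℝ] ℝ)))

theorem stdLiouville_apply (y : Euc n × (Euc n →L[ℝ] ℝ)) (u : Fin 1 → Euc n × (Euc n →L[ℝ] ℝ)) :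
    stdLiouville n y u = y.2 (u 0).1 := rfl

theorem isManifold_one_cotangent : IsManifold (cot n) 1 (Cotangent n L) :=
  IsManifold.of_le (n := ∞) (by simp)

/-- This is `θ = ∑ ξᵢ dxᵢ`: in the chart the bundle projection becomes the first projection, and `α`
becomes its fibre coordinate `ξ`. The coefficients are linear in the point, so the derivative needed
for `dθ` is `stdLiouville` itself. -/
theorem liouville_inChart (α : Cotangent n L) :
    EqOn (DiffForm.inChart (liouville n L) α) (stdLiouville n) (extChartAt (cot n) α).target := by
  have := isManifold_one_cotangent (n := n) (L := L)
  intro y hy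
  ext u
  rw [DiffForm.inChart_apply, stdLiouville_apply]
  have h1 := mfderiv_extChartAt_comp_mfderivWithin_extChartAt_symm hy
  have hβ := (extChartAt (cot n) α).map_target hy
  have hr := (extChartAt (cot n) α).right_inv hy
  have hrange : range (cot n) = univ := ModelWithCorners.range_eq_univ _
  rw [hrange, mfderivWithin_univ] at h1
  have h2 : mvfderiv (cot n) (extChartAt (cot n) α) ((extChartAt (cot n) α).symm y)
      (mfderiv 𝓘(ℝ, Euc n × (Euc n →L[ℝ] ℝ)) (cot n) (extChartAt (cot n) α).symm y (u 0)) = u 0 :=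
    DFunLike.congr_fun h1 (u 0)
  generalize hw : mfderiv 𝓘(ℝ, Euc n × (Euc n →L[ℝ] ℝ)) (cot n) (extChartAt (cot n) α).symm y
    (u 0) = w at h2
  show ((extChartAt (cot n) α).symm y).snd (mfderiv (cot n) (𝓡 n) TotalSpace.proj
    ((extChartAt (cot n) α).symm y) (mfderiv 𝓘(ℝ, Euc n × (Euc n →L[ℝ] ℝ)) (cot n)
      (extChartAt (cot n) α).symm y (u 0))) = _
  rw [hw]
  clear hw h1
  generalize (extChartAt (cot n) α).symm y = β at *
  have hβ' : β ∈ (chartAt (ModelProd (Euc n) (Euc n →L[ℝ] ℝ)) α).source := by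
    simpa only [extChartAt_source] using hβ
  have hp : β.proj ∈ (chartAt (Euc n) α.proj).source := by
    rw [FiberBundle.chartedSpace_chartAt] at hβ'
    simpa [cotTriv_fst] using hβ'
  rw [extChartAt_eq_cotTriv] at hr
  rw [← cotTriv_snd_apply α.proj β hp, congr_arg Prod.snd hr, ← h2]
  congr 1
  have h4 := mvfderiv_clm_comp (ContinuousLinearMap.fst ℝ (Euc n) (Euc n →L[ℝ] ℝ))
    (mdifferentiableAt_extChartAt hβ') w
  have h5 : mfderiv (cot n) (𝓡 n) (chartAt (Euc n) α.proj ∘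
      (TotalSpace.proj : Cotangent n L → L)) β = _ :=
    mfderiv_comp (I' := 𝓡 n) β (mdifferentiableAt_of_mem_atlas (chart_mem_atlas _ _) hp)
      (contMDiff_proj (n := 1) _ β |>.mdifferentiableAt one_ne_zero)
  have h6 : mvfderiv (cot n) (chartAt (Euc n) α.proj ∘
      (TotalSpace.proj : Cotangent n L → L)) β w = mvfderiv (𝓡 n) (chartAt (Euc n) α.proj) β.proj
        (mfderiv (cot n) (𝓡 n) TotalSpace.proj β w) := DFunLike.congr_fun h5 w
  rw [← h6]
  refine Eq.trans ?_ h4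
  refine mvfderiv_eq_of_eventuallyEq (Filter.Eventually.of_forall fun γ => ?_) w
  rw [extChartAt_eq_cotTriv]
  rfl

theorem canonicalForm_apply (α : Cotangent n L) (v w : TangentSpace (cot n) α) :
    canonicalForm n L α ![v, w] = stdForm n ![mvfderiv (cot n) (cotChart α.proj) α v,
      mvfderiv (cot n) (cotChart α.proj) α w] := by
  have := isManifold_one_cotangent (n := n) (L := L)
  have h1 : DiffForm.inChart (liouville n L) α =ᶠ[𝓝 (extChartAt (cot n) α α)] stdLiouville n :=
    (liouville_inChart α).eventuallyEq_of_mem (extChartAt_target_mem_nhds α)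
  have h2 : canonicalForm n L α ![v, w] = -DiffForm.d (liouville n L) α ![v, w] := rfl
  rw [h2, DiffForm.d_apply, h1.extDeriv_eq, extDeriv, ContinuousLinearMap.fderiv,
    ContinuousAlternatingMap.alternatizeUncurryFin_apply, stdForm_apply_inner]
  -- The Riesz isometry turns the preferred chart of the cotangent bundle into `cotChart`. The sign
  -- in `-dθ` makes the base coordinate play the role of `p`.
  set P : Euc n × (Euc n →L[ℝ] ℝ) →L[ℝ] Euc n × Euc n :=
    (ContinuousLinearMap.id ℝ (Euc n)).prodMap
      (InnerProductSpace.toDual ℝ (Euc n)).symm.toContinuousLinearEquiv.toContinuousLinearMap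
  have h3 (u : TangentSpace (cot n) α) : mvfderiv (cot n) (cotChart α.proj) α u =
      P (mvfderiv (cot n) (extChartAt (cot n) α) α u) := by
    rw [← mvfderiv_clm_comp P (mdifferentiableAt_extChartAt (mem_chart_source _ α))]
    refine mvfderiv_eq_of_eventuallyEq (Filter.Eventually.of_forall fun β => ?_) u
    rw [extChartAt_eq_cotTriv]
    exact Prod.ext (cotChart_fst _ _) (cotChart_snd _ _)
  rw [h3, h3]
  generalize mvfderiv (cot n) (extChartAt (cot n) α) α = D
  simp [P, Fin.removeNth, stdLiouville_apply, sub_eq_add_neg]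

end CanonicalForm

/-! ### The quotient of the cotangent bundle by integral translations -/

section Quotient

variable {n : ℕ} {L : Type*} [TopologicalSpace L] [ChartedSpace (Euc n) L] [IsAffineManifold n L]
  {x₀ : L}

/-- The equivalence relation on the cotangent bundle defined by integral translations. -/
def integralSetoid (b : Module.Basis (Fin n) ℝ (TangentSpace (𝓡 n) x₀)) :
    Setoid (Cotangent n L) where
  r := IsIntegralTranslate b
  iseqv :=
    { refl := fun α => ⟨α.proj, α.snd, 0, zero_mem _, rfl, by rw [add_zero]⟩
      symm := by
        rintro _ _ ⟨x, a, c, hc, rfl, rfl⟩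
        exact ⟨x, a + c, -c, neg_mem hc, rfl, by rw [add_neg_cancel_right]⟩
      trans := by
        rintro _ _ _ ⟨x, a, c, hc, rfl, rfl⟩ ⟨x', a', c', hc', h, rfl⟩
        obtain rfl : x = x' := congr_arg TotalSpace.proj h
        obtain rfl := TotalSpace.mk_inj.1 h
        exact ⟨x, a, c + c', add_mem hc hc', rfl, by rw [add_assoc]⟩ }

/-- The quotient of the cotangent bundle by integral translations. -/
def TorusBundle (b : Module.Basis (Fin n) ℝ (TangentSpace (𝓡 n) x₀)) : Type _ :=
  Quotient (integralSetoid b)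

instance (b : Module.Basis (Fin n) ℝ (TangentSpace (𝓡 n) x₀)) : TopologicalSpace (TorusBundle b) :=
  inferInstanceAs (TopologicalSpace (Quotient (integralSetoid b)))

/-- The quotient map from the cotangent bundle. -/
def TorusBundle.mk (b : Module.Basis (Fin n) ℝ (TangentSpace (𝓡 n) x₀)) (α : Cotangent n L) :
    TorusBundle b := Quotient.mk (integralSetoid b) α

variable {b : Module.Basis (Fin n) ℝ (TangentSpace (𝓡 n) x₀)}

/-- The projection of the torus bundle to its base. -/
def TorusBundle.proj : TorusBundle b → L :=
  Quotient.lift (s := integralSetoid b) TotalSpace.proj (by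
    rintro _ _ ⟨x, a, c, hc, rfl, rfl⟩
    rfl)

namespace TorusBundle

theorem proj_mk (α : Cotangent n L) : (mk b α).proj = α.proj := rfl

theorem mk_eq_mk_iff {α β : Cotangent n L} : mk b α = mk b β ↔ IsIntegralTranslate b α β :=
  Quotient.eq (r := integralSetoid b)

theorem isQuotientMap_mk : Topology.IsQuotientMap (mk b) := isQuotientMap_quotient_mk'

theorem surjective_mk : Function.Surjective (mk b) := isQuotientMap_mk.surjective

theorem continuous_mk : Continuous (mk b) := isQuotientMap_mk.continuous

theorem continuous_proj : Continuous (proj : TorusBundle b → L) :=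
  isQuotientMap_mk.continuous_iff.2
    (FiberBundle.continuous_proj (Euc n →L[ℝ] ℝ) fun x : L => TangentSpace (𝓡 n) x →L[ℝ] ℝ)

variable [ConnectedSpace L]

/-- An integral translation of a covector extends to integral translations of nearby covectors,
which are translations in canonical coordinates. -/
theorem exists_local_translation (hb : HasIntegralHolonomy b) {α β : Cotangent n L}
    (h : IsIntegralTranslate b α β) {x : L} (hx : α.proj ∈ (chartAt (Euc n) x).source) :
    ∃ (d : Euc n) (τ : Cotangent n L → Cotangent n L), ContinuousAt τ α ∧ τ α = β ∧
      ∀ᶠ α' in 𝓝 α, mk b (τ α') = mk b α' ∧ cotChart x (τ α') = cotChart x α' + (0, d) := by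
  obtain ⟨U, hU, hqU, hUs, c, hc⟩ := hb.exists_isIntegralTranslate_iff hx
  obtain ⟨h1, h2⟩ := (hc α β hqU).1 h
  have hα : α ∈ (cotChart x).source := mem_cotChart_source.2 hx
  have hβ : β ∈ (cotChart x).source := mem_cotChart_source.2 (h1 ▸ hx)
  set d := (cotChart x β).2 - (cotChart x α).2 with hd
  have h3 : cotChart x α + (0, d) = cotChart x β := by
    refine Prod.ext ?_ ?_
    · rw [Prod.fst_add, cotChart_fst, cotChart_fst, h1, add_zero]
    · rw [Prod.snd_add, hd, add_sub_cancel]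
  have hpα : ContinuousAt (TotalSpace.proj : Cotangent n L → L) α :=
    (FiberBundle.continuous_proj (Euc n →L[ℝ] ℝ)
      fun x : L => TangentSpace (𝓡 n) x →L[ℝ] ℝ).continuousAt
  -- The lattice condition on `d` involves only the basis `c`, which is the same over all of `U`; so
  -- translation by the fixed vector `d` is integral at every nearby covector.
  refine ⟨d, fun α' => (cotChart x).symm (cotChart x α' + (0, d)), ?_, ?_, ?_⟩
  · refine ContinuousAt.comp (g := (cotChart x).symm) ?_
      (((cotChart x).continuousAt hα).add continuousAt_const)
    rw [h3]
    exact (cotChart x).continuousAt_symm ((cotChart x).map_source hβ)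
  · simp only [h3]
    exact (cotChart x).left_inv hβ
  · filter_upwards [hpα.eventually (hU.mem_nhds hqU)] with α' hα'
    have hα'U : α'.proj ∈ U := hα'
    have ht : (cotChart x α' + (0, d)).1 = chartAt (Euc n) x α'.proj := by
      rw [Prod.fst_add, cotChart_fst, add_zero]
    have ht' : (cotChart x α' + (0, d)).1 ∈ (chartAt (Euc n) x).target := by
      rw [ht]
      exact (chartAt (Euc n) x).map_source (hUs hα'U)
    have hr := (cotChart x).right_inv (mem_cotChart_target.2 ht')
    refine ⟨(mk_eq_mk_iff.2 ((hc _ _ hα'U).2 ⟨?_, fun i => ?_⟩)).symm, hr⟩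
    · rw [cotChart_symm_proj ht', ht, (chartAt (Euc n) x).left_inv (hUs hα'U)]
    · rw [hr, Prod.snd_add, add_sub_cancel_left]
      exact h2 i

/-- The saturation of an open set `W` is open: if a translate of `α` lies in `W`, the local
translation `τ` carries a neighbourhood of `α` into `W`. -/
theorem isOpenMap_mk (hb : HasIntegralHolonomy b) : IsOpenMap (mk b) := by
  intro W hW
  rw [← isQuotientMap_mk.isOpen_preimage, isOpen_iff_mem_nhds]
  rintro α ⟨β, hβW, hβ⟩
  obtain ⟨d, τ, hτ, hτα, h⟩ := exists_local_translation hb (mk_eq_mk_iff.1 hβ.symm)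
    (mem_chart_source (Euc n) α.proj)
  filter_upwards [h, hτ.eventually (hW.mem_nhds (hτα ▸ hβW))] with α' h1 h2
  exact ⟨_, h2, h1.1⟩

theorem exists_injOn_mk (hb : HasIntegralHolonomy b) (α : Cotangent n L) :
    ∃ W : Set (Cotangent n L), IsOpen W ∧ α ∈ W ∧ InjOn (mk b) W := by
  have hx := mem_chart_source (Euc n) α.proj
  set x := α.proj with hxα
  obtain ⟨U, hU, hqU, hUs, c, hc⟩ := hb.exists_isIntegralTranslate_iff hx
  have hcont : ContinuousOn (cotChart x) (TotalSpace.proj ⁻¹' U) :=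
    (cotChart x).continuousOn.mono fun β hβ => mem_cotChart_source.2 (hUs hβ)
  have hU' : IsOpen (TotalSpace.proj ⁻¹' U : Set (Cotangent n L)) :=
    hU.preimage (FiberBundle.continuous_proj (Euc n →L[ℝ] ℝ)
      fun x : L => TangentSpace (𝓡 n) x →L[ℝ] ℝ)
  -- Two points of this box have fibre coordinates whose difference pairs with each `c i` to less
  -- than `1` in absolute value. If these pairings are integers, they vanish.
  set B : Set (Euc n × Euc n) :=
    {y | ∀ i, |inner ℝ (y.2 - (cotChart x α).2) (c i)| < 1 / 2} with hB
  have hBo : IsOpen B := by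
    rw [hB, ofPred_forall]
    exact isOpen_iInter_of_finite fun i => isOpen_lt (by fun_prop) continuous_const
  refine ⟨_, hcont.isOpen_inter_preimage hU' hBo, ⟨hqU, fun i => by simp⟩, ?_⟩
  rintro β ⟨hβ, hβB⟩ γ ⟨hγ, hγB⟩ h
  obtain ⟨h1, h2⟩ := (hc β γ hβ).1 (mk_eq_mk_iff.1 h)
  have h3 : (cotChart x γ).2 - (cotChart x β).2 = 0 := by
    refine InnerProductSpace.ext_inner_right_basis c fun i => ?_
    obtain ⟨k, hk⟩ := h2 i
    have h4 := hβB i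
    have h5 := hγB i
    have h6 : inner ℝ ((cotChart x γ).2 - (cotChart x β).2) (c i) =
        inner ℝ ((cotChart x γ).2 - (cotChart x α).2) (c i) -
          inner ℝ ((cotChart x β).2 - (cotChart x α).2) (c i) := by
      rw [← inner_sub_left, sub_sub_sub_cancel_right]
    have h7 : |(k : ℝ)| < 1 := by
      rw [← hk, h6]
      exact (abs_sub _ _).trans_lt (by linarith)
    have h8 : k = 0 := by
      rw [← Int.abs_lt_one_iff]
      exact_mod_cast h7
    rw [hk, h8]
    simp
  refine (cotChart x).injOn (mem_cotChart_source.2 (hUs hβ)) (mem_cotChart_source.2 (hUs hγ)) ?_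
  refine Prod.ext ?_ (sub_eq_zero.1 h3).symm
  rw [cotChart_fst, cotChart_fst, h1]

theorem isLocalHomeomorph_mk (hb : HasIntegralHolonomy b) : IsLocalHomeomorph (mk b) := by
  rw [isLocalHomeomorph_iff_isOpenEmbedding_restrict]
  intro α
  obtain ⟨W, hW, hα, hinj⟩ := exists_injOn_mk hb α
  exact ⟨W, hW.mem_nhds hα, .of_continuous_injective_isOpenMap
    (continuous_mk.comp continuous_subtype_val) (injOn_iff_injective.1 hinj)
    ((isOpenMap_mk hb).domRestrict hW)⟩

/-- The chart of the torus bundle defined by a local inverse of the quotient map and canonical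
coordinates of the cotangent bundle. -/
def cotCoord (e : OpenPartialHomeomorph (Cotangent n L) (TorusBundle b)) (x : L) :
    OpenPartialHomeomorph (TorusBundle b) (Euc n × Euc n) := e.symm ≫ₕ cotChart x

theorem mk_mem_cotCoord_source {e : OpenPartialHomeomorph (Cotangent n L) (TorusBundle b)}
    (he : mk b = e) {x : L} {α : Cotangent n L} (hα : α ∈ e.source)
    (hx : α.proj ∈ (chartAt (Euc n) x).source) : mk b α ∈ (cotCoord e x).source := by
  rw [cotCoord, OpenPartialHomeomorph.trans_source, he]
  refine ⟨e.map_source hα, ?_⟩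
  rw [mem_preimage, e.left_inv hα]
  exact mem_cotChart_source.2 hx

theorem cotCoord_mk {e : OpenPartialHomeomorph (Cotangent n L) (TorusBundle b)}
    (he : mk b = e) (x : L) {α : Cotangent n L} (hα : α ∈ e.source) :
    cotCoord e x (mk b α) = cotChart x α := by
  rw [cotCoord, OpenPartialHomeomorph.coe_trans, Function.comp_apply, he, e.left_inv hα]

theorem exists_of_mem_cotCoord_source {e : OpenPartialHomeomorph (Cotangent n L) (TorusBundle b)}
    (he : mk b = e) {x : L} {m : TorusBundle b} (hm : m ∈ (cotCoord e x).source) :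
    ∃ α ∈ e.source, mk b α = m ∧ α.proj ∈ (chartAt (Euc n) x).source := by
  rw [cotCoord, OpenPartialHomeomorph.trans_source] at hm
  exact ⟨e.symm m, e.map_target hm.1, by rw [he, e.right_inv hm.1], mem_cotChart_source.1 hm.2⟩

/-- The lifts of `m` by the two local inverses differ by an integral translation. The transition is
thus a coordinate change of the cotangent bundle followed by a translation `(0, d)`, which leaves
the linear part unchanged. -/
theorem exists_cotCoord_transition (hb : HasIntegralHolonomy b)
    {e e' : OpenPartialHomeomorph (Cotangent n L) (TorusBundle b)} (he : mk b = e)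
    (he' : mk b = e') {x x' : L} {m : TorusBundle b} (hm : m ∈ (cotCoord e x).source)
    (hm' : m ∈ (cotCoord e' x').source) :
    ∃ A : Euc n × Euc n →ᵃ[ℝ] Euc n × Euc n, IsSymplecticAffine A ∧
      ∀ᶠ m' in 𝓝 m, cotCoord e' x' m' = A (cotCoord e x m') := by
  obtain ⟨α, hα, rfl, hx⟩ := exists_of_mem_cotCoord_source he hm
  obtain ⟨β, hβ, hβα, hx'⟩ := exists_of_mem_cotCoord_source he' hm'
  have hp : β.proj = α.proj := congr_arg proj hβα
  rw [hp] at hx'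
  obtain ⟨A, hA, hA'⟩ := exists_cotChart_transition hx hx'
  obtain ⟨d, τ, hτ, hτα, h⟩ := exists_local_translation hb (mk_eq_mk_iff.1 hβα.symm) hx'
  refine ⟨(A + AffineMap.const ℝ _ (0, d) : _ →ᵃ[ℝ] _), by simpa [IsSymplecticAffine] using hA, ?_⟩
  have hpα : ContinuousAt (TotalSpace.proj : Cotangent n L → L) α :=
    (FiberBundle.continuous_proj (Euc n →L[ℝ] ℝ)
      fun x : L => TangentSpace (𝓡 n) x →L[ℝ] ℝ).continuousAt
  have h1 : ∀ᶠ α' in 𝓝 α, cotCoord e' x' (mk b α') =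
      (A + AffineMap.const ℝ _ (0, d) : _ →ᵃ[ℝ] _) (cotCoord e x (mk b α')) := by
    filter_upwards [h, hτ.eventually (e'.open_source.mem_nhds (hτα.symm ▸ hβ)),
      e.open_source.mem_nhds hα, hpα.eventually hA'] with α' h2 h3 h4 h5
    rw [← h2.1, cotCoord_mk he' x' h3, h2.2, h2.1, cotCoord_mk he x h4, h5 α' rfl]
    simp
  rw [← (isLocalHomeomorph_mk hb).map_nhds_eq α]
  exact h1

/-- The torus bundle is a `2n`-manifold. -/
abbrev chartedSpace (hb : HasIntegralHolonomy b) : ChartedSpace (Euc n × Euc n) (TorusBundle b) where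
  atlas := {φ | ∃ (e : OpenPartialHomeomorph (Cotangent n L) (TorusBundle b)) (x : L),
    mk b = e ∧ φ = cotCoord e x}
  chartAt m := cotCoord (isLocalHomeomorph_mk hb (surjective_mk m).choose).choose
    (surjective_mk m).choose.proj
  mem_chart_source m := by
    have h := (isLocalHomeomorph_mk hb (surjective_mk m).choose).choose_spec
    have h1 := mk_mem_cotCoord_source h.2 h.1 (mem_chart_source _ _)
    rwa [(surjective_mk m).choose_spec] at h1
  chart_mem_atlas m := ⟨_, _, (isLocalHomeomorph_mk hb (surjective_mk m).choose).choose_spec.2, rfl⟩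

theorem hasGroupoid (hb : HasIntegralHolonomy b) :
    letI := chartedSpace hb
    HasGroupoid (TorusBundle b) (sympAffineGroupoid n) := by
  let := chartedSpace hb
  have key : ∀ {e e' : OpenPartialHomeomorph (Cotangent n L) (TorusBundle b)} {x x' : L},
      mk b = e → mk b = e' → (sympAffinePregroupoid n).property
        ((cotCoord e x).symm ≫ₕ cotCoord e' x') ((cotCoord e x).symm ≫ₕ cotCoord e' x').source := by
    intro e e' x x' he he' y hy
    rw [OpenPartialHomeomorph.trans_source, OpenPartialHomeomorph.symm_source] at hy
    obtain ⟨A, hA, h⟩ := exists_cotCoord_transition hb he he' ((cotCoord e x).map_target hy.1) hy.2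
    refine ⟨A, hA, ?_⟩
    filter_upwards [((cotCoord e x).continuousAt_symm hy.1).eventually h,
      (cotCoord e x).open_target.mem_nhds hy.1] with z h1 h2
    rw [(cotCoord e x).right_inv h2] at h1
    exact h1
  refine ⟨?_⟩
  intro φ ψ hφ hψ
  obtain ⟨e, x, he, rfl⟩ : φ ∈ {φ | ∃ (e : OpenPartialHomeomorph (Cotangent n L) (TorusBundle b))
    (x : L), mk b = e ∧ φ = cotCoord e x} := hφ
  obtain ⟨e', x', he', rfl⟩ : ψ ∈ {φ | ∃ (e : OpenPartialHomeomorph (Cotangent n L) (TorusBundle b))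
    (x : L), mk b = e ∧ φ = cotCoord e x} := hψ
  exact mem_groupoid_of_pregroupoid.2 ⟨key he he', key he' he⟩

theorem cotCoord_mem_maximalAtlas (hb : HasIntegralHolonomy b)
    {e : OpenPartialHomeomorph (Cotangent n L) (TorusBundle b)} (he : mk b = e) (x : L) :
    letI := chartedSpace hb
    cotCoord e x ∈ (sympAffineGroupoid n).maximalAtlas (TorusBundle b) := by
  let := chartedSpace hb
  have := hasGroupoid hb
  have h : cotCoord e x ∈ atlas (Euc n × Euc n) (TorusBundle b) :=
    show ∃ (e' : OpenPartialHomeomorph (Cotangent n L) (TorusBundle b)) (x' : L),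
      mk b = e' ∧ cotCoord e x = cotCoord e' x' from ⟨e, x, he, rfl⟩
  exact (sympAffineGroupoid n).subset_maximalAtlas h

end TorusBundle

end Quotient

/-! ### The torus bundle as a topological fibre bundle -/

section Torus

/-- The coordinates of a vector given by the scalar products with the members of a basis. -/
def pairingEquiv {n : ℕ} (c : Module.Basis (Fin n) ℝ (Euc n)) : Euc n ≃L[ℝ] (Fin n → ℝ) :=
  (LinearEquiv.ofInjectiveOfFinrankEq (LinearMap.pi fun i => (innerₗ (Euc n)).flip (c i))
    (fun ξ η h => InnerProductSpace.ext_inner_right_basis c fun i => congr_fun h i)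
    (by simp)).toContinuousLinearEquiv

theorem pairingEquiv_apply {n : ℕ} (c : Module.Basis (Fin n) ℝ (Euc n)) (ξ : Euc n) (i : Fin n) :
    pairingEquiv c ξ i = inner ℝ ξ (c i) := rfl

/-- The universal covering of the torus. -/
def torusMk (n : ℕ) (s : Fin n → ℝ) : Fin n → UnitAddCircle := fun i => (s i : UnitAddCircle)

theorem isOpenQuotientMap_torusMk (n : ℕ) : IsOpenQuotientMap (torusMk n) :=
  IsOpenQuotientMap.piMap fun _ => QuotientAddGroup.isOpenQuotientMap_mk

theorem torusMk_eq_iff {n : ℕ} {s t : Fin n → ℝ} :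
    torusMk n s = torusMk n t ↔ ∀ i, ∃ k : ℤ, t i - s i = k := by
  rw [funext_iff]
  refine forall_congr' fun i => ?_
  rw [torusMk, torusMk, eq_comm, ← sub_eq_zero, ← AddCircle.coe_sub, AddCircle.coe_eq_zero_iff]
  simp [eq_comm]

namespace TorusBundle

variable {n : ℕ} {L : Type*} [TopologicalSpace L] [ChartedSpace (Euc n) L] [IsAffineManifold n L]
  {x₀ : L} {b : Module.Basis (Fin n) ℝ (TangentSpace (𝓡 n) x₀)} [ConnectedSpace L]

/-- The torus bundle is locally trivial. -/
theorem exists_trivialization (hb : HasIntegralHolonomy b) (x : L) :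
    ∃ (e : Trivialization (Fin n → UnitAddCircle) (proj : TorusBundle b → L))
      (C : Euc n ≃L[ℝ] (Fin n → ℝ)), x ∈ e.baseSet ∧ e.baseSet ⊆ (chartAt (Euc n) x).source ∧
      ∀ y ∈ e.baseSet, ∀ s, e.toOpenPartialHomeomorph.symm (y, torusMk n s) =
        mk b ((cotChart x).symm (chartAt (Euc n) x y, C.symm s)) := by
  obtain ⟨U, hU, hxU, hUs, c, hc⟩ := hb.exists_isIntegralTranslate_iff (mem_chart_source (Euc n) x)
  set C := pairingEquiv c
  -- Pairing with `c` turns the lattice into `ℤⁿ`, so the classes of the pairings modulo `1`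
  -- separate exactly the points of each fibre of the quotient.
  have hC : ∀ α β : Cotangent n L, α.proj ∈ U → (mk b α = mk b β ↔ β.proj = α.proj ∧
      torusMk n (C (cotChart x α).2) = torusMk n (C (cotChart x β).2)) := by
    intro α β hα
    rw [mk_eq_mk_iff, hc α β hα, torusMk_eq_iff]
    simp_rw [C, pairingEquiv_apply, ← inner_sub_left]
  -- The formula uses a chosen representative covector; by `hC` the value over `U` does not depend
  -- on it.
  set f : TorusBundle b → L × (Fin n → UnitAddCircle) := fun m =>
    (m.proj, torusMk n (C (cotChart x (Function.surjInv surjective_mk m)).2)) with hf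
  have hfmk : ∀ α : Cotangent n L, α.proj ∈ U →
      f (mk b α) = (α.proj, torusMk n (C (cotChart x α).2)) := by
    intro α hα
    refine Prod.ext rfl ?_
    exact (((hC α _ hα).1 (Function.surjInv_eq surjective_mk (mk b α)).symm).2).symm
  set σ : L → (Fin n → ℝ) → TorusBundle b := fun y s =>
    mk b ((cotChart x).symm (chartAt (Euc n) x y, C.symm s)) with hσ
  have hfσ : ∀ y ∈ U, ∀ s, f (σ y s) = (y, torusMk n s) := by
    intro y hy s
    have h1 := cotChart_symm_mk_proj (hUs hy) (C.symm s)
    rw [hσ, hfmk _ (by rwa [h1]), h1, cotChart_cotChart_symm (hUs hy)]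
    simp
  have hσs : ∀ y ∈ U, ∀ s s', torusMk n s = torusMk n s' → σ y s = σ y s' := by
    intro y hy s s' h
    have h1 := cotChart_symm_mk_proj (hUs hy) (C.symm s)
    have h2 := cotChart_symm_mk_proj (hUs hy) (C.symm s')
    refine (hC _ _ (by rwa [h1])).2 ⟨h2.trans h1.symm, ?_⟩
    rw [cotChart_cotChart_symm (hUs hy), cotChart_cotChart_symm (hUs hy)]
    simpa using h
  have hσmk : ∀ α : Cotangent n L, α.proj ∈ U → σ α.proj (C (cotChart x α).2) = mk b α := by
    intro α hα
    simp only [hσ, ContinuousLinearEquiv.symm_apply_apply]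
    rw [cotChart_symm_cotChart (hUs hα)]
  have hsurj := (isOpenQuotientMap_torusMk n).surjective
  set g : L × (Fin n → UnitAddCircle) → TorusBundle b := fun p =>
    σ p.1 (Function.surjInv hsurj p.2) with hg
  have hgσ : ∀ y ∈ U, ∀ s, g (y, torusMk n s) = σ y s := fun y hy s =>
    hσs y hy _ _ (Function.surjInv_eq hsurj _)
  let e : Trivialization (Fin n → UnitAddCircle) (proj : TorusBundle b → L) :=
    { toFun := f
      invFun := g
      source := proj ⁻¹' U
      target := U ×ˢ univ
      map_source' := fun m hm => ⟨hm, trivial⟩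
      map_target' := by
        rintro ⟨y, t⟩ ⟨hy, -⟩
        obtain ⟨s, rfl⟩ := hsurj t
        rw [hgσ y hy]
        have h1 : (σ y s).proj = y := congr_arg Prod.fst (hfσ y hy s)
        rw [mem_preimage, h1]
        exact hy
      left_inv' := by
        intro m hm
        obtain ⟨α, rfl⟩ := surjective_mk m
        rw [hfmk α hm, hgσ α.proj hm, hσmk α hm]
      right_inv' := by
        rintro ⟨y, t⟩ ⟨hy, -⟩
        obtain ⟨s, rfl⟩ := hsurj t
        rw [hgσ y hy, hfσ y hy]
      open_source := hU.preimage continuous_proj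
      open_target := hU.prod isOpen_univ
      continuousOn_toFun := by
        intro m hm
        obtain ⟨α, rfl⟩ := surjective_mk m
        refine ContinuousAt.continuousWithinAt ?_
        rw [ContinuousAt, ← (isLocalHomeomorph_mk hb).map_nhds_eq α, Filter.tendsto_map'_iff]
        have hp := (FiberBundle.continuous_proj (Euc n →L[ℝ] ℝ)
          fun x : L => TangentSpace (𝓡 n) x →L[ℝ] ℝ)
        have h1 : ContinuousAt (fun α : Cotangent n L =>
            (α.proj, torusMk n (C (cotChart x α).2))) α :=
          hp.continuousAt.prodMk ((isOpenQuotientMap_torusMk n).continuous.continuousAt.comp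
            (C.continuous.continuousAt.comp
              ((cotChart x).continuousAt (mem_cotChart_source.2 (hUs hm))).snd))
        rw [hfmk α hm]
        refine Filter.Tendsto.congr' ?_ h1
        filter_upwards [(hU.preimage hp).mem_nhds hm] with α' hα'
        exact (hfmk α' hα').symm
      continuousOn_invFun := by
        rintro ⟨y, t⟩ ⟨hy, -⟩
        obtain ⟨s, rfl⟩ := hsurj t
        refine ContinuousAt.continuousWithinAt ?_
        -- Neighbourhoods in `L × Tⁿ` are images of neighbourhoods in `L × ℝⁿ`, so continuity of the
        -- inverse reduces to that of `σ`.
        have hq := IsOpenQuotientMap.prodMap (IsOpenQuotientMap.id (X := L))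
          (isOpenQuotientMap_torusMk n)
        have h0 : 𝓝 (y, torusMk n s) = Filter.map (Prod.map id (torusMk n)) (𝓝 (y, s)) :=
          (hq.map_nhds_eq (y, s)).symm
        rw [ContinuousAt, h0, Filter.tendsto_map'_iff, hgσ y hy]
        have h1 : ContinuousAt (fun p : L × (Fin n → ℝ) => σ p.1 p.2) (y, s) := by
          have h2 : Continuous (fun p : L × (Fin n → ℝ) => (p.1, C.symm p.2)) := by fun_prop
          refine continuous_mk.continuousAt.comp ?_
          exact ContinuousAt.comp (f := fun p : L × (Fin n → ℝ) => (p.1, C.symm p.2)) (x := (y, s))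
            (continuousAt_cotChart_symm (hUs hy) (C.symm s)) h2.continuousAt
        refine Filter.Tendsto.congr' ?_ h1
        filter_upwards [(hU.preimage continuous_fst).mem_nhds (show (y, s).1 ∈ U from hy)]
          with p hp
        exact (hgσ p.1 hp p.2).symm
      baseSet := U
      open_baseSet := hU
      source_eq := rfl
      target_eq := rfl
      proj_toFun := fun m hm => rfl }
  exact ⟨e, C, hxU, hUs, hgσ⟩

theorem t2Space [T2Space L] (hb : HasIntegralHolonomy b) : T2Space (TorusBundle b) := by
  refine ⟨fun m m' hne => ?_⟩
  by_cases h : m.proj = m'.proj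
  · obtain ⟨e, -, hx, -, -⟩ := exists_trivialization hb m.proj
    have hm : m ∈ e.source := e.mem_source.2 hx
    have hm' : m' ∈ e.source := e.mem_source.2 (h ▸ hx)
    obtain ⟨u, v, hu, hv, hmu, hmv, hd⟩ :=
      t2_separation (fun h' => hne (e.toOpenPartialHomeomorph.injOn hm hm' h') : e m ≠ e m')
    exact ⟨_, _, e.toOpenPartialHomeomorph.isOpen_inter_preimage hu,
      e.toOpenPartialHomeomorph.isOpen_inter_preimage hv, ⟨hm, hmu⟩, ⟨hm', hmv⟩,
      (hd.preimage e).mono inter_subset_right inter_subset_right⟩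
  · obtain ⟨u, v, hu, hv, hmu, hmv, hd⟩ := t2_separation h
    exact ⟨_, _, hu.preimage continuous_proj, hv.preimage continuous_proj, hmu, hmv,
      hd.preimage _⟩

theorem compactSpace [CompactSpace L] [T2Space L] (hb : HasIntegralHolonomy b) :
    CompactSpace (TorusBundle b) := by
  have h : ∀ x : L, ∃ (K : Set L) (S : Set (TorusBundle b)), K ∈ 𝓝 x ∧ IsCompact S ∧
      proj ⁻¹' K ⊆ S := by
    intro x
    obtain ⟨e, -, hx, -, -⟩ := exists_trivialization hb x
    obtain ⟨K, hK, hKe, hKc⟩ := local_compact_nhds (e.open_baseSet.mem_nhds hx)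
    refine ⟨K, e.toOpenPartialHomeomorph.symm '' (K ×ˢ univ), hK,
      (hKc.prod isCompact_univ).image_of_continuousOn
        (e.toOpenPartialHomeomorph.continuousOn_symm.mono ?_), fun m hm => ?_⟩
    · rintro ⟨y, t⟩ ⟨hy, -⟩
      exact e.mem_target.2 (hKe hy)
    · have hm' : m ∈ e.source := e.mem_source.2 (hKe hm)
      refine ⟨e m, ⟨?_, trivial⟩, e.toOpenPartialHomeomorph.left_inv hm'⟩
      rw [e.coe_fst hm']
      exact hm
  choose K S hK hS hKS using h
  obtain ⟨t, ht⟩ := finite_cover_nhds hK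
  refine ⟨(t.isCompact_biUnion fun x _ => hS x).of_isClosed_subset isClosed_univ fun m _ => ?_⟩
  obtain ⟨x, hx, hm⟩ := mem_iUnion₂.1 (ht.symm ▸ mem_univ m.proj : m.proj ∈ ⋃ x ∈ t, K x)
  exact mem_iUnion₂.2 ⟨x, hx, hKS x hm⟩

end TorusBundle

end Torus

/-! ### The symplectic manifold structure of the torus bundle -/

theorem isLocalDiffeomorphAt_of_openPartialHomeomorph {E E' : Type*} [NormedAddCommGroup E]
    [NormedSpace ℝ E] [NormedAddCommGroup E'] [NormedSpace ℝ E'] {H H' : Type*}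
    [TopologicalSpace H] [TopologicalSpace H'] {I : ModelWithCorners ℝ E H}
    {J : ModelWithCorners ℝ E' H'} {M N : Type*} [TopologicalSpace M] [ChartedSpace H M]
    [TopologicalSpace N] [ChartedSpace H' N] {f : M → N} {x : M} (g : OpenPartialHomeomorph M N)
    (hx : x ∈ g.source) (hg : ContMDiffOn I J ∞ g g.source)
    (hg' : ContMDiffOn J I ∞ g.symm g.target) (h : EqOn f g g.source) :
    IsLocalDiffeomorphAt I J ∞ f x :=
  ⟨⟨g.toPartialEquiv, g.open_source, g.open_target, hg, hg'⟩, hx, h⟩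

section Smooth

variable {n : ℕ} {L : Type*} [TopologicalSpace L] [ChartedSpace (Euc n) L] [IsAffineManifold n L]

/-- Up to the Riesz isometry `P`, `cotChart x` is the preferred chart of the cotangent bundle at
`(x, 0)`. -/
theorem contMDiffOn_cotChart (x : L) :
    ContMDiffOn (cot n) (dbl n) ∞ (cotChart (n := n) x) (cotChart (n := n) x).source := by
  set P : Euc n × (Euc n →L[ℝ] ℝ) →L[ℝ] Euc n × Euc n :=
    (ContinuousLinearMap.id ℝ (Euc n)).prodMap
      (InnerProductSpace.toDual ℝ (Euc n)).symm.toContinuousLinearEquiv.toContinuousLinearMap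
  have h1 := contMDiffOn_extChartAt (I := cot n) (n := ∞) (x := (⟨x, 0⟩ : Cotangent n L))
  have h2 : ContMDiffOn (cot n) (dbl n) ∞
      (P ∘ extChartAt (cot n) (⟨x, 0⟩ : Cotangent n L)) _ := P.contMDiff.comp_contMDiffOn h1
  refine (h2.mono ?_).congr fun β hβ => ?_
  · intro β hβ
    rw [FiberBundle.chartedSpace_chartAt]
    simpa [cotTriv_fst] using mem_cotChart_source.1 hβ
  · rw [Function.comp_apply, extChartAt_eq_cotTriv]
    exact Prod.ext (cotChart_fst _ _) (cotChart_snd _ _)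

theorem contMDiffOn_cotChart_symm (x : L) :
    ContMDiffOn (dbl n) (cot n) ∞ (cotChart (n := n) x).symm (cotChart (n := n) x).target := by
  set P : Euc n × Euc n →L[ℝ] Euc n × (Euc n →L[ℝ] ℝ) :=
    (ContinuousLinearMap.id ℝ (Euc n)).prodMap
      (InnerProductSpace.toDual ℝ (Euc n)).toContinuousLinearEquiv.toContinuousLinearMap
  have h1 := contMDiffOn_extChartAt_symm (I := cot n) (n := ∞) (⟨x, 0⟩ : Cotangent n L)
  have h0 : MapsTo P (cotChart (n := n) x).target
      (extChartAt (cot n) (⟨x, 0⟩ : Cotangent n L)).target ∧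
      ∀ y ∈ (cotChart (n := n) x).target, (cotChart x).symm y =
        (extChartAt (cot n) (⟨x, 0⟩ : Cotangent n L)).symm (P y) := by
    have h3 : ∀ y ∈ (cotChart (n := n) x).target,
        P y = extChartAt (cot n) (⟨x, 0⟩ : Cotangent n L) ((cotChart x).symm y) ∧
        (cotChart x).symm y ∈ (extChartAt (cot n) (⟨x, 0⟩ : Cotangent n L)).source := by
      intro y hy
      have hs := (cotChart x).map_target hy
      constructor
      · conv_lhs => rw [← (cotChart x).right_inv hy]
        rw [extChartAt_eq_cotTriv]
        refine Prod.ext (cotChart_fst _ _) ?_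
        exact (InnerProductSpace.toDual ℝ (Euc n)).apply_symm_apply _
      · rw [extChartAt_source, FiberBundle.chartedSpace_chartAt]
        simpa [cotTriv_fst] using mem_cotChart_source.1 hs
    refine ⟨fun y hy => ?_, fun y hy => ?_⟩
    · rw [(h3 y hy).1]
      exact (extChartAt (cot n) (⟨x, 0⟩ : Cotangent n L)).map_source (h3 y hy).2
    · rw [(h3 y hy).1, (extChartAt (cot n) (⟨x, 0⟩ : Cotangent n L)).left_inv (h3 y hy).2]
  exact (h1.comp P.contMDiff.contMDiffOn h0.1).congr h0.2

namespace TorusBundle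

variable {x₀ : L} {b : Module.Basis (Fin n) ℝ (TangentSpace (𝓡 n) x₀)} [ConnectedSpace L]
  [hb : Fact (HasIntegralHolonomy b)]

instance : ChartedSpace (Euc n × Euc n) (TorusBundle b) := chartedSpace hb.out

instance : HasGroupoid (TorusBundle b) (sympAffineGroupoid n) := hasGroupoid hb.out

instance : IsManifold (dbl n) ∞ (TorusBundle b) := isManifold_of_sympAffine

theorem cotCoord_mem {e : OpenPartialHomeomorph (Cotangent n L) (TorusBundle b)} (he : mk b = e)
    (x : L) : cotCoord e x ∈ (sympAffineGroupoid n).maximalAtlas (TorusBundle b) :=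
  cotCoord_mem_maximalAtlas hb.out he x

theorem contMDiffOn_cotCoord {e : OpenPartialHomeomorph (Cotangent n L) (TorusBundle b)}
    (he : mk b = e) (x : L) : ContMDiffOn (dbl n) (dbl n) ∞ (cotCoord e x) (cotCoord e x).source :=
  contMDiffOn_of_mem_maximalAtlas (mem_maximalAtlas_of_sympAffine (cotCoord_mem he x))

theorem contMDiffOn_cotCoord_symm {e : OpenPartialHomeomorph (Cotangent n L) (TorusBundle b)}
    (he : mk b = e) (x : L) :
    ContMDiffOn (dbl n) (dbl n) ∞ (cotCoord e x).symm (cotCoord e x).target :=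
  contMDiffOn_symm_of_mem_maximalAtlas (mem_maximalAtlas_of_sympAffine (cotCoord_mem he x))

theorem cotCoord_symm {e : OpenPartialHomeomorph (Cotangent n L) (TorusBundle b)}
    (he : mk b = e) (x : L) (y : Euc n × Euc n) :
    (cotCoord e x).symm y = mk b ((cotChart x).symm y) := by
  rw [he]
  rfl

theorem mem_cotCoord_target {e : OpenPartialHomeomorph (Cotangent n L) (TorusBundle b)}
    {x : L} {y : Euc n × Euc n} : y ∈ (cotCoord e x).target ↔
      y.1 ∈ (chartAt (Euc n) x).target ∧ (cotChart x).symm y ∈ e.source := by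
  rw [cotCoord, OpenPartialHomeomorph.trans_target, mem_inter_iff, mem_cotChart_target]
  rfl

/-- Read in `cotChart` and `cotCoord`, the quotient map is the identity. -/
theorem isLocalDiffeomorph_mk : IsLocalDiffeomorph (cot n) (dbl n) ∞ (mk b) := by
  intro α
  obtain ⟨e, hα, he⟩ := isLocalHomeomorph_mk hb.out α
  have hx := mem_chart_source (Euc n) α.proj
  have hs := mem_cotChart_source.2 hx
  refine isLocalDiffeomorphAt_of_openPartialHomeomorph
    (cotChart α.proj ≫ₕ (cotCoord e α.proj).symm) ?_ ?_ ?_ ?_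
  · rw [OpenPartialHomeomorph.trans_source]
    refine ⟨hs, ?_⟩
    rw [mem_preimage, OpenPartialHomeomorph.symm_source, mem_cotCoord_target,
      (cotChart α.proj).left_inv hs, cotChart_fst]
    exact ⟨(chartAt (Euc n) α.proj).map_source hx, hα⟩
  · exact (contMDiffOn_cotCoord_symm he α.proj).comp ((contMDiffOn_cotChart α.proj).mono
      inter_subset_left) fun β hβ => hβ.2
  · rw [OpenPartialHomeomorph.trans_symm_eq_symm_trans_symm, OpenPartialHomeomorph.symm_symm]
    exact (contMDiffOn_cotChart_symm α.proj).comp ((contMDiffOn_cotCoord he α.proj).mono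
      fun β hβ => hβ.1) fun β hβ => hβ.2
  · intro β hβ
    rw [OpenPartialHomeomorph.coe_trans, Function.comp_apply, cotCoord_symm he,
      (cotChart α.proj).left_inv hβ.1]

/-- Both forms are the standard form, in coordinates that correspond under the quotient map. -/
theorem sympAffineForm_mk (α : Cotangent n L) (v w : TangentSpace (cot n) α) :
    sympAffineForm n (TorusBundle b) (mk b α)
      ![mfderiv (cot n) (dbl n) (mk b) α v, mfderiv (cot n) (dbl n) (mk b) α w] =
        canonicalForm n L α ![v, w] := by
  obtain ⟨e, hα, he⟩ := isLocalHomeomorph_mk hb.out α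
  have hm := mk_mem_cotCoord_source he hα (mem_chart_source (Euc n) α.proj)
  rw [sympAffineForm_apply (cotCoord_mem he α.proj) hm, canonicalForm_apply]
  have h1 : mfderiv (cot n) (dbl n) (cotCoord e α.proj ∘ mk b) α = _ :=
    mfderiv_comp (I' := dbl n) α (mdifferentiableAt_of_sympAffine (cotCoord_mem he α.proj) hm)
      ((isLocalDiffeomorph_mk α).mdifferentiableAt (by simp))
  have h2 : cotCoord e α.proj ∘ mk b =ᶠ[𝓝 α] cotChart α.proj := by
    filter_upwards [e.open_source.mem_nhds hα] with β hβ
    exact cotCoord_mk he α.proj hβ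
  have h3 (u : TangentSpace (cot n) α) : mvfderiv (dbl n) (cotCoord e α.proj) (mk b α)
      (mfderiv (cot n) (dbl n) (mk b) α u) = mvfderiv (cot n) (cotChart α.proj) α u := by
    rw [← mvfderiv_eq_of_eventuallyEq h2]
    exact (DFunLike.congr_fun h1 u).symm
  rw [h3, h3]

/-- In the coordinates of the torus bundle, the horizontal sections are horizontal slices. -/
theorem exists_cotCoord_horizontal {x y : L} (hy : y ∈ (chartAt (Euc n) x).source) (ξ : Euc n) :
    ∃ e : OpenPartialHomeomorph (Cotangent n L) (TorusBundle b), mk b = e ∧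
      (cotChart x).symm (chartAt (Euc n) x y, ξ) ∈ e.source ∧
      ∀ᶠ z in 𝓝 y, z ∈ (chartAt (Euc n) x).source ∧
        mk b ((cotChart x).symm (chartAt (Euc n) x z, ξ)) ∈ (cotCoord e x).source ∧
        cotCoord e x (mk b ((cotChart x).symm (chartAt (Euc n) x z, ξ))) =
          (chartAt (Euc n) x z, ξ) := by
  obtain ⟨e, hα, he⟩ := isLocalHomeomorph_mk hb.out ((cotChart x).symm (chartAt (Euc n) x y, ξ))
  refine ⟨e, he, hα, ?_⟩
  have h1 : ContinuousAt (fun z => (cotChart x).symm (chartAt (Euc n) x z, ξ)) y :=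
    ContinuousAt.comp (f := fun z => (z, ξ)) (continuousAt_cotChart_symm hy ξ) (by fun_prop)
  filter_upwards [(chartAt (Euc n) x).open_source.mem_nhds hy,
    h1.eventually (e.open_source.mem_nhds hα)] with z hz hz'
  refine ⟨hz, mk_mem_cotCoord_source he hz' ?_, ?_⟩
  · rwa [cotChart_symm_mk_proj hz]
  · rw [cotCoord_mk he x hz', cotChart_cotChart_symm hz]

theorem isLeafwiseAt_horizontal {x y : L} (hy : y ∈ (chartAt (Euc n) x).source) (ξ : Euc n) :
    (sympAffineFoliation n (TorusBundle b)).IsLeafwiseAt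
      (fun z => mk b ((cotChart x).symm (chartAt (Euc n) x z, ξ))) y := by
  obtain ⟨e, he, -, h⟩ := exists_cotCoord_horizontal (b := b) hy ξ
  refine ⟨cotCoord e x, cotCoord_mem he x, h.self_of_nhds.2.1, ?_⟩
  filter_upwards [h] with z hz
  exact ⟨hz.2.1, by rw [hz.2.2, h.self_of_nhds.2.2]⟩

end TorusBundle

end Smooth

/-! ### Leafwise maps, the zero section as a leaf, and the torus suspension -/

theorem Foliation.IsLeafwiseAt.congr {n : ℕ} {M : Type*} [TopologicalSpace M]
    [ChartedSpace (Euc n × Euc n) M] {F : Foliation n M} {X : Type*} [TopologicalSpace X]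
    {f g : X → M} {x : X} (h : F.IsLeafwiseAt f x) (hfg : g =ᶠ[𝓝 x] f) : F.IsLeafwiseAt g x := by
  obtain ⟨φ, hφ, hx, h⟩ := h
  refine ⟨φ, hφ, by rwa [hfg.self_of_nhds], ?_⟩
  filter_upwards [h, hfg] with z hz hz'
  rwa [hz', hfg.self_of_nhds]

theorem Foliation.IsLeafwiseAt.comp {n : ℕ} {M : Type*} [TopologicalSpace M]
    [ChartedSpace (Euc n × Euc n) M] {F : Foliation n M} {X Y : Type*} [TopologicalSpace X]
    [TopologicalSpace Y] {f : X → M} {g : Y → X} {y : Y} (h : F.IsLeafwiseAt f (g y))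
    (hg : ContinuousAt g y) : F.IsLeafwiseAt (fun z => f (g z)) y := by
  obtain ⟨φ, hφ, hx, h⟩ := h
  exact ⟨φ, hφ, hx, hg.eventually h⟩

namespace TorusBundle

variable {n : ℕ} {L : Type*} [TopologicalSpace L] [ChartedSpace (Euc n) L] [IsAffineManifold n L]
  {x₀ : L} (b : Module.Basis (Fin n) ℝ (TangentSpace (𝓡 n) x₀))

/-- The zero section of the torus bundle. -/
def zeroSection (x : L) : TorusBundle b := mk b ⟨x, 0⟩

variable {b}

theorem proj_zeroSection (x : L) : (zeroSection b x).proj = x := rfl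

theorem zeroSection_eventuallyEq {x y : L} (hy : y ∈ (chartAt (Euc n) x).source) :
    zeroSection b =ᶠ[𝓝 y] fun z => mk b ((cotChart x).symm (chartAt (Euc n) x z, 0)) := by
  filter_upwards [(chartAt (Euc n) x).open_source.mem_nhds hy] with z hz
  rw [cotChart_symm_zero hz, zeroSection]

theorem continuous_zeroSection : Continuous (zeroSection b) := by
  refine continuous_iff_continuousAt.2 fun x => ?_
  have hx := mem_chart_source (Euc n) x
  refine ContinuousAt.congr ?_ (zeroSection_eventuallyEq hx).symm
  exact continuous_mk.continuousAt.comp (ContinuousAt.comp (f := fun z => (z, (0 : Euc n)))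
    (continuousAt_cotChart_symm hx 0) (by fun_prop))

variable [ConnectedSpace L] [hb : Fact (HasIntegralHolonomy b)]

theorem isLeafwiseAt_zeroSection (x : L) :
    (sympAffineFoliation n (TorusBundle b)).IsLeafwiseAt (zeroSection b) x :=
  (isLeafwiseAt_horizontal (mem_chart_source (Euc n) x) 0).congr
    (zeroSection_eventuallyEq (mem_chart_source (Euc n) x))

theorem exists_cotCoord_zeroSection (x : L) :
    ∃ e : OpenPartialHomeomorph (Cotangent n L) (TorusBundle b), mk b = e ∧
      ∀ᶠ z in 𝓝 x, z ∈ (chartAt (Euc n) x).source ∧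
        zeroSection b z ∈ (cotCoord e x).source ∧
        cotCoord e x (zeroSection b z) = (chartAt (Euc n) x z, 0) := by
  have hx := mem_chart_source (Euc n) x
  obtain ⟨e, he, -, h⟩ := exists_cotCoord_horizontal (b := b) hx 0
  refine ⟨e, he, ?_⟩
  filter_upwards [h, zeroSection_eventuallyEq hx] with z hz h0
  rw [h0]
  exact hz

theorem inducesAffineStructure_zeroSection :
    (sympAffineFoliation n (TorusBundle b)).InducesAffineStructure
      (sympAffineForm n (TorusBundle b)) (zeroSection b) := by
  intro x
  obtain ⟨e, he, h⟩ := exists_cotCoord_zeroSection (b := b) x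
  refine ⟨cotCoord e x, isAdaptedDarboux_sympAffine (cotCoord_mem he x), h.self_of_nhds.2.1,
    AffineEquiv.refl ℝ _, ?_⟩
  filter_upwards [h] with z hz
  rw [hz.2.2]
  rfl

theorem isImmersion_zeroSection : Manifold.IsImmersion (𝓡 n) (dbl n) ∞ (zeroSection b) := by
  refine ⟨Euc n, inferInstance, inferInstance, fun x => ?_⟩
  obtain ⟨e, he, h⟩ := exists_cotCoord_zeroSection (b := b) x
  obtain ⟨V, hV, hVo, hxV⟩ := eventually_nhds_iff.1 h
  -- In these charts the zero section is `y ↦ (y, 0)`. The chart of `L` is restricted to `V` so that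
  -- the image stays in the domain of the single chart `cotCoord e x`.
  refine .mk_of_continuousAt continuous_zeroSection.continuousAt
    (ContinuousLinearEquiv.refl ℝ (Euc n × Euc n)) ((chartAt (Euc n) x).restr V) (cotCoord e x)
    ?_ h.self_of_nhds.2.1 ?_ (mem_maximalAtlas_of_sympAffine (cotCoord_mem he x)) ?_
  · rw [OpenPartialHomeomorph.restr_source' _ _ hVo]
    exact ⟨mem_chart_source _ x, hxV⟩
  · exact restr_mem_maximalAtlas _ (IsManifold.chart_mem_maximalAtlas x) hVo
  · intro y hy
    have hy' : y ∈ ((chartAt (Euc n) x).restr V).target := by simpa using hy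
    have h1 := ((chartAt (Euc n) x).restr V).map_target hy'
    rw [OpenPartialHomeomorph.restr_source' _ _ hVo] at h1
    have h2 := hV _ h1.2
    have h3 := ((chartAt (Euc n) x).restr V).right_inv hy'
    show cotCoord e x (zeroSection b (((chartAt (Euc n) x).restr V).symm y)) = (y, 0)
    rw [h2.2.2]
    exact Prod.ext h3 rfl

/-- Paths in `L` pushed by the zero section are leafwise, so its range lies in the leaf. Conversely,
along a leafwise path the times spent in the range form a closed set, since the range is compact in
a Hausdorff space, and an open one, since `q` remains `0` near such a time. The interval is
connected and time `0` belongs to this set. -/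
theorem range_zeroSection [CompactSpace L] [T2Space L] (x : L) :
    range (zeroSection b) =
      (sympAffineFoliation n (TorusBundle b)).leaf (zeroSection b x) := by
  have := t2Space hb.out
  apply Subset.antisymm
  · rintro _ ⟨y, rfl⟩
    have : LocallyPathConnectedSpace L := ChartedSpace.locallyPathConnectedSpace (Euc n) L
    have : PathConnectedSpace L := pathConnectedSpace_iff_connectedSpace.2 inferInstance
    obtain ⟨γ⟩ := PathConnectedSpace.joined x y
    exact ⟨γ.map continuous_zeroSection, fun t =>
      (isLeafwiseAt_zeroSection (γ t)).comp γ.continuous.continuousAt⟩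
  · rintro m ⟨γ, hγ⟩
    have hclosed : IsClosed (γ ⁻¹' range (zeroSection b)) :=
      (isCompact_range continuous_zeroSection).isClosed.preimage γ.continuous
    have hopen : IsOpen (γ ⁻¹' range (zeroSection b)) := by
      rw [isOpen_iff_mem_nhds]
      rintro t ⟨y, hy⟩
      obtain ⟨φ, hφ, ht, h⟩ := hγ t
      obtain ⟨e, he, h'⟩ := exists_cotCoord_zeroSection (b := b) y
      have h1 := h'.self_of_nhds.2
      rw [hy] at h1
      obtain ⟨W, hW, h2⟩ := (sympAffineFoliation n (TorusBundle b)).compatible φ hφ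
        (cotCoord e y) (cotCoord_mem he y) (γ t) ⟨ht, h1.1⟩
      filter_upwards [h, γ.continuous.continuousAt.eventually hW,
        γ.continuous.continuousAt.eventually ((cotCoord e y).open_source.mem_nhds h1.1)]
        with s h3 h4 h5
      -- The slice of `γ` in the chart `φ` is also a slice of `cotCoord e y` near `γ t`; there `q =
      -- 0`, so `γ s` comes from a zero covector.
      have h6 := h2 (γ s) h4 (γ t) (mem_of_mem_nhds hW) h3.2
      obtain ⟨α, hα, hαs, hαy⟩ := exists_of_mem_cotCoord_source he h5
      rw [← hαs, cotCoord_mk he y hα, h1.2] at h6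
      refine ⟨α.proj, ?_⟩
      rw [zeroSection, ← hαs, ← cotChart_symm_zero hαy, ← cotChart_symm_cotChart hαy, h6]
      rw [cotChart_symm_mk_proj hαy]
    have huniv := IsClopen.eq_univ ⟨hclosed, hopen⟩ ⟨0, x, by simp⟩
    have h1 : (1 : unitInterval) ∈ γ ⁻¹' range (zeroSection b) := huniv ▸ mem_univ _
    simpa using h1

theorem isLeafEmbedding_zeroSection [CompactSpace L] [T2Space L] :
    (sympAffineFoliation n (TorusBundle b)).IsLeafEmbedding (zeroSection b) where
  smoothEmbedding := by
    have := t2Space hb.out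
    exact ⟨isImmersion_zeroSection, (continuous_zeroSection.isClosedEmbedding
      (Function.LeftInverse.injective proj_zeroSection)).isEmbedding⟩
  leafwise := isLeafwiseAt_zeroSection
  range_eq := range_zeroSection

theorem isTorusSuspension :
    (sympAffineFoliation n (TorusBundle b)).IsTorusSuspension (proj : TorusBundle b → L) := by
  intro x
  obtain ⟨T, C, hxT, hTs, hT⟩ := exists_trivialization hb.out x
  refine ⟨T, hxT, ?_, fun t y hy => ?_⟩
  · rintro ⟨⟨y, s⟩, hy, -⟩
    have hys := hTs hy
    obtain ⟨e, he, hα, -⟩ := exists_cotCoord_horizontal (b := b) hys (C.symm s)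
    have hr : ((chartAt (Euc n) x).restr T.baseSet).source = T.baseSet := by
      rw [OpenPartialHomeomorph.restr_source' _ _ T.open_baseSet, inter_eq_right.2 hTs]
    -- On `U × ℝⁿ` the trivialization is the product of the affine chart and `C.symm`, followed by
    -- the inverse of a chart of the quotient.
    refine isLocalDiffeomorphAt_of_openPartialHomeomorph
      ((((chartAt (Euc n) x).restr T.baseSet).prod
        C.symm.toHomeomorph.toOpenPartialHomeomorph) ≫ₕ (cotCoord e x).symm) ?_ ?_ ?_ ?_
    · rw [OpenPartialHomeomorph.trans_source, OpenPartialHomeomorph.prod_source, hr]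
      refine ⟨⟨hy, trivial⟩, ?_⟩
      rw [mem_preimage, OpenPartialHomeomorph.symm_source, mem_cotCoord_target]
      exact ⟨(chartAt (Euc n) x).map_source hys, hα⟩
    · refine (contMDiffOn_cotCoord_symm he x).comp ?_ fun p hp => hp.2
      have h1 : ContMDiffOn ((𝓡 n).prod 𝓘(ℝ, Fin n → ℝ)) (𝓡 n) ∞
          (fun p : L × (Fin n → ℝ) => chartAt (Euc n) x p.1)
          (Prod.fst ⁻¹' (chartAt (Euc n) x).source) :=
        (contMDiffOn_chart (I := 𝓡 n) (n := ∞) (x := x)).comp contMDiff_fst.contMDiffOn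
          fun p hp => hp
      have h2 : ContMDiffOn ((𝓡 n).prod 𝓘(ℝ, Fin n → ℝ)) (𝓡 n) ∞
          (fun p : L × (Fin n → ℝ) => C.symm p.2) (Prod.fst ⁻¹' (chartAt (Euc n) x).source) :=
        (C.symm.contDiff.contMDiff.comp contMDiff_snd).contMDiffOn
      refine (h1.prodMk_space h2).mono fun p hp => ?_
      rw [OpenPartialHomeomorph.trans_source, OpenPartialHomeomorph.prod_source, hr] at hp
      exact hTs hp.1.1
    · rw [OpenPartialHomeomorph.trans_symm_eq_symm_trans_symm, OpenPartialHomeomorph.symm_symm]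
      have h0 : ContMDiffOn (dbl n) (dbl n) ∞ (cotCoord e x) (cotCoord e x).source :=
        contMDiffOn_cotCoord he x
      have h1 : ContMDiffOn (dbl n) (𝓡 n) ∞ (fun m => (cotCoord e x m).1) (cotCoord e x).source :=
        (contDiff_fst.contMDiff (𝕜 := ℝ)).comp_contMDiffOn h0
      have h2 : ContMDiffOn (dbl n) 𝓘(ℝ, Fin n → ℝ) ∞ (fun m => C (cotCoord e x m).2)
          (cotCoord e x).source :=
        ((C.contDiff.comp contDiff_snd).contMDiff (𝕜 := ℝ)).comp_contMDiffOn h0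
      have h3 : ContMDiffOn (dbl n) (𝓡 n) ∞ (fun m => (chartAt (Euc n) x).symm (cotCoord e x m).1)
          (cotCoord e x).source :=
        (contMDiffOn_chart_symm (I := 𝓡 n) (n := ∞) (x := x)).comp h1 fun m hm => by
          obtain ⟨α, hα, rfl, hαx⟩ := exists_of_mem_cotCoord_source he hm
          rw [mem_preimage, cotCoord_mk he x hα, cotChart_fst]
          exact (chartAt (Euc n) x).map_source hαx
      exact (h3.prodMk h2).mono fun m hm => hm.1
    · rintro ⟨y', s'⟩ hp
      rw [OpenPartialHomeomorph.trans_source, OpenPartialHomeomorph.prod_source, hr] at hp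
      rw [OpenPartialHomeomorph.coe_trans, Function.comp_apply, cotCoord_symm he]
      exact hT y' hp.1.1 s'
  -- A lift `s` of `t` turns the slice `U × {t}` into a section with the constant fibre coordinate
  -- `C.symm s`.
  · obtain ⟨s, rfl⟩ := (isOpenQuotientMap_torusMk n).surjective t
    refine (isLeafwiseAt_horizontal (hTs hy) (C.symm s)).congr ?_
    filter_upwards [T.open_baseSet.mem_nhds hy] with z hz
    exact hT z hz s

end TorusBundle

end AffSymp

end

theorem proposition2p3 {n : ℕ} {L : Type u} [TopologicalSpace L] [ChartedSpace (Euc n) L]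
    [IsAffineManifold n L] [CompactSpace L] [T2Space L] [ConnectedSpace L]
    (x₀ : L) (b : Module.Basis (Fin n) ℝ (TangentSpace (𝓡 n) x₀)) (hb : HasIntegralHolonomy b) :
    ∃ (M : Type u) (_ : TopologicalSpace M) (_ : ChartedSpace (Euc n × Euc n) M)
      (_ : IsManifold (dbl n) ∞ M) (Ω : DiffForm (dbl n) M 2) (F : Foliation n M)
      (quo : Cotangent n L → M) (p : M → L),
      -- a compact symplectic manifold with a Lagrangian foliation
      CompactSpace M ∧ T2Space M ∧ IsSymplectic Ω ∧ F.IsLagrangian Ω ∧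
      -- the affine manifold `L` is a leaf, embedded as the image of the zero section
      F.IsLeafEmbedding (fun x : L => quo ⟨x, 0⟩) ∧
      F.InducesAffineStructure Ω (fun x : L => quo ⟨x, 0⟩) ∧
      -- `M` is the quotient of the cotangent bundle by the fibrewise integer translations
      Function.Surjective quo ∧ IsLocalDiffeomorph (cot n) (dbl n) ∞ quo ∧
      (∀ α β, quo α = quo β ↔ IsIntegralTranslate b α β) ∧
      -- its symplectic form is induced by the one of the cotangent bundle
      (∀ (α : Cotangent n L) (v w : TangentSpace (cot n) α),
        Ω (quo α) ![mfderiv (cot n) (dbl n) quo α v, mfderiv (cot n) (dbl n) quo α w] =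
          canonicalForm n L α ![v, w]) ∧
      -- it is a torus bundle over `L`, the suspension of `Tⁿ`
      (∀ α, p (quo α) = α.proj) ∧ F.IsTorusSuspension p := by
  have : Fact (HasIntegralHolonomy b) := ⟨hb⟩
  exact ⟨TorusBundle b, inferInstance, inferInstance, inferInstance,
    sympAffineForm n (TorusBundle b), sympAffineFoliation n (TorusBundle b), TorusBundle.mk b,
    TorusBundle.proj, TorusBundle.compactSpace hb, TorusBundle.t2Space hb,
    isSymplectic_sympAffineForm, isLagrangian_sympAffineFoliation,
    TorusBundle.isLeafEmbedding_zeroSection, TorusBundle.inducesAffineStructure_zeroSection,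
    TorusBundle.surjective_mk, TorusBundle.isLocalDiffeomorph_mk,
    fun _ _ => TorusBundle.mk_eq_mk_iff, TorusBundle.sympAffineForm_mk,
    TorusBundle.proj_mk, TorusBundle.isTorusSuspension⟩
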